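/- **Theorem.** Let $\mathbb{K}$ be the field of reversed Hahn series $\sum_{\gamma\in\mathbb{R}}c_\gamma t^\gamma$ with coefficients $c_\gamma\in\mathbb{C}$, i.e. every nonempty subset of the support $\{\gamma: c_\gamma\neq 0\}$ has a largest element. Let $\nu(c)$ be the largest exponent in the support of $c\neq 0$, and $\nu(0)=-\infty$; thus $c=\lambda t^{\nu(c)}+o(t^{\nu(c)})$ with $\lambda\in\mathbb{C}^*$ for $c\ne0$, where $o(t^\alpha)$ stands for elements of valuation $<\alpha$. Let $n\in\mathbb{N}$. Every $z\in\mathbb{K}^n\setminus\{0\}$ can be written uniquely as $z=t^\alpha B+o(t^\alpha)$ with $\alpha=\max_i\nu(z_i)\in\mathbb{R}$ and $B\in\mathbb{C}^n\setminus\{0\}$; put $\mathrm{In}_\nu(z)=(\alpha,B)$ and, for $X\subseteq\mathbb{K}^n$, $\mathrm{In}_\nu(X)=\{\mathrm{In}_\nu(z): z\in X,\ z\neq 0\}\subseteq\mathbb{R}\times\mathbb{C}^n$. For $\alpha\in\mathbb{R}$ and a nonzero $f=\sum_u c_u x^u\in\mathbb{K}[x_1,\dots,x_n]$, with $c_u=\lambda_u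 t^{\nu(c_u)}+o(t^{\nu(c_u)})$ when $c_u\ne0$, put $|u|=u_1+\dots+u_n$ and $$\nu_\alpha(f)=\max\{\nu(c_u)+\alpha|u| : c_u\neq 0\},\qquad \mathrm{IN}_\alpha(f)=\sum_{u:\ c_u\neq 0,\ \nu(c_u)+\alpha|u|=\nu_\alpha(f)}\lambda_u X^u\in\mathbb{C}[X_1,\dots,X_n],$$ and put $\mathrm{IN}_\alpha(0)=0$. For an ideal $I\subseteq\mathbb{K}[x_1,\dots,x_n]$ let $\mathrm{IN}_\alpha(I)$ be the ideal of $\mathbb{C}[X_1,\dots,X_n]$ generated by all $\mathrm{IN}_\alpha(f)$, $f\in I$. Let $I\subseteq\mathbb{K}[x_1,\dots,x_n]$ be any ideal and $X=\mathbb{V}(I)\subseteq\mathbb{K}^n$ its zero set. Then: 1. $$\mathrm{In}_\nu(X)=\bigsqcup_{\alpha\in\mathbb{R}}\mathbb{V}(\mathrm{IN}_\alpha(I))\setminus\{0\}:=\bigcup_{\alpha\in\mathbb{R}}\{\alpha\}\times\bigl(\mathbb{V}(\mathrm{IN}_\alpha(I))\setminus\{0\}\bigr).$$ 2. There is a finite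 (possibly empty) set of real numbers $\beta_0<\dots<\beta_r$, the critical levels, such that, with $\beta_{-1}=-\infty$ and $\beta_{r+1}=+\infty$, for every $i=0,\dots,r+1$ the ideal $\mathrm{IN}_\alpha(I)$ is homogeneous (for the standard grading) and does not depend on $\alpha$ for $\alpha\in(\beta_{i-1},\beta_i)$, while for every $i=0,\dots,r$ the ideal $\mathrm{IN}_{\beta_i}(I)$ is not homogeneous. (If there are no critical levels, then $r=-1$ and the only interval is $\mathbb{R}$.) -/

import Mathlib

noncomputable section

namespace AffineTrop

/-- The field `𝕂` of reversed Hahn series `∑ c_γ t^γ` with complex coefficients and real exponents.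
The exponents are taken in `ℝᵒᵈ`, so every nonempty subset of the support has a largest element
for the usual order of `ℝ`. The series `c t^γ` is `HahnSeries.single (OrderDual.toDual γ) c`. -/
abbrev RevHahn : Type := HahnSeries ℝᵒᵈ ℂ

open Classical in
/-- The (max-convention) valuation `ν`: the largest exponent in the support, and `ν 0 = -∞`. -/
def val (c : RevHahn) : WithBot ℝ :=
  if c = 0 then ⊥ else ((OrderDual.ofDual c.order : ℝ) : WithBot ℝ)

/-- `V_ν(z) = max_i ν(z_i)`; it is `-∞` exactly when `z = 0`. -/
def vecVal {n : ℕ} (z : Fin n → RevHahn) : WithBot ℝ :=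
  Finset.univ.sup fun i => val (z i)

/-- The leading part `In_ν(z) = (α, B)` of a nonzero vector `z = B t^α + o(t^α)`: the level is
`α = V_ν(z)` and `B` is the vector of coefficients of `t^α` in the entries of `z`
(so `B_i = 0` when `ν(z_i) < α`). The value at `z = 0` is irrelevant. -/
def leadingPart {n : ℕ} (z : Fin n → RevHahn) : ℝ × (Fin n → ℂ) :=
  ((vecVal z).unbotD 0, fun i => (z i).coeff (OrderDual.toDual ((vecVal z).unbotD 0)))

/-- `In_ν(X)`, the set of leading parts of the nonzero points of `X`. -/
def leadingParts {n : ℕ} (X : Set (Fin n → RevHahn)) : Set (ℝ × (Fin n → ℂ)) :=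
  leadingPart '' (X \ {0})

/-- The value `ν(c_u) + α|u|` of the term of `f` with exponent `u`. -/
def termVal {n : ℕ} (α : ℝ) (f : MvPolynomial (Fin n) RevHahn) (u : Fin n →₀ ℕ) : WithBot ℝ :=
  val (f.coeff u) + ((α * (u.degree : ℝ) : ℝ) : WithBot ℝ)

/-- `ν_α(f) = max {ν(c_u) + α|u| : c_u ≠ 0}`, and `-∞` for `f = 0`. -/
def polyVal {n : ℕ} (α : ℝ) (f : MvPolynomial (Fin n) RevHahn) : WithBot ℝ :=
  f.support.sup (termVal α f)

open Classical in
/-- The initial form `IN_α(f) = ∑ λ_u X^u`, over the exponents `u` of `f` with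
`ν(c_u) + α|u| = ν_α(f)`, where `c_u = λ_u t^{ν(c_u)} + o(t^{ν(c_u)})`. -/
def initForm {n : ℕ} (α : ℝ) (f : MvPolynomial (Fin n) RevHahn) : MvPolynomial (Fin n) ℂ :=
  ∑ u ∈ f.support with termVal α f u = polyVal α f,
    MvPolynomial.monomial u (f.coeff u).leadingCoeff

/-- `IN_α(I)`, the ideal generated by the initial forms of the elements of `I`. -/
def initIdeal {n : ℕ} (α : ℝ) (I : Ideal (MvPolynomial (Fin n) RevHahn)) :
    Ideal (MvPolynomial (Fin n) ℂ) :=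
  Ideal.span {F | ∃ f ∈ I, initForm α f = F}

attribute [local instance] MvPolynomial.gradedAlgebra in
/-- Homogeneous ideals, for the standard grading of the polynomial ring (each `X_i` of degree 1). -/
def IsHomogeneousIdeal {n : ℕ} (J : Ideal (MvPolynomial (Fin n) ℂ)) : Prop :=
  J.IsHomogeneous (MvPolynomial.homogeneousSubmodule (Fin n) ℂ)

/-- For `β_0 < … < β_{r-1}` and `0 ≤ i ≤ r`, the open interval `(β_{i-1}, β_i)`, where
`β_{-1} = -∞` and `β_r = +∞`. -/
def gap {r : ℕ} (β : Fin r → ℝ) (i : Fin (r + 1)) : Set ℝ :=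
  {α | ∀ j : Fin r, (j.castSucc < i → β j < α) ∧ (i ≤ j.castSucc → α < β j)}

end AffineTrop

end

/-! Write `𝕂` for `RevHahn`. If `z = t^α B + o(t^α)` and `ν_α(f) ≤ γ`, the coefficient of `t^γ` in
`f(z)` is the weight-`γ` part of `f` evaluated at `B` (`coeff_eval`). This gives the easy inclusion
in the first claim.

For the converse, translate and rescale so that `B` becomes the origin and `α` becomes `0`. A zero
with all valuations negative is then wanted for an ideal whose initial forms at level `0` have no
constant term. The same holds at some level slightly below `0`, so the ring of polynomials bounded
by `1` at that level, enlarged by the ideal, does not contain `t`. By Zorn it lies in a subring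
maximal among those without `t`, which behaves like the unit ball of a multiplicative seminorm:
integrally closed, with elements of norm one cancellable and invertible modulo those of norm less
than one. Its residue field is `ℂ`, because a transcendental `x` would give uncountably many
independent elements `1/(x - r)` whereas the polynomial ring has countable dimension over `𝕂`. Since
`𝕂` is maximally complete, every element has a best approximation in `𝕂`, and a residue field no
larger than `ℂ` forces the error to have norm zero. So the seminorm comes from a `𝕂`-point
(`exists_algHom_of_tpowIn_one_notMem`), which is the required zero.

For the second claim, let `α` tend to `x` from one side, or to `±∞`. Along such a filter a single
polynomial eventually has a constant homogeneous initial form. A dimension count in bounded degree,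
with noetherianity of a homogenized ideal for uniformity in the degree, shows that `IN_α(I)` is
eventually constant and homogeneous (`eventually_mem_initIdeal_iff`). Critical levels thus cannot
accumulate, even at infinity. Where `IN_x(I)` is homogeneous it is locally constant, because nearby
initial forms are homogeneous components of those at `x`; connectedness of the gaps concludes. -/

noncomputable section

namespace AffineTrop

open OrderDual

/-! ### The valuation of reversed Hahn series. -/

/-- The series with no exponents above `γ`, i.e. of valuation at most `γ`. -/
def valLE (γ : ℝ) : AddSubgroup RevHahn where
  carrier := {c | ∀ δ, γ < δ → c.coeff (toDual δ) = 0}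
  add_mem' ha hb δ hδ := by simp [ha δ hδ, hb δ hδ]
  zero_mem' := by simp
  neg_mem' hc δ hδ := by simp [hc δ hδ]

/-- The series all of whose exponents are below `γ`, i.e. of valuation less than `γ`. -/
def valLT (γ : ℝ) : AddSubgroup RevHahn where
  carrier := {c | ∀ δ, γ ≤ δ → c.coeff (toDual δ) = 0}
  add_mem' ha hb δ hδ := by simp [ha δ hδ, hb δ hδ]
  zero_mem' := by simp
  neg_mem' hc δ hδ := by simp [hc δ hδ]

theorem mem_valLE {γ : ℝ} {c : RevHahn} :
    c ∈ valLE γ ↔ ∀ δ, γ < δ → c.coeff (toDual δ) = 0 := Iff.rfl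

theorem valLT_le_valLE (γ : ℝ) : valLT γ ≤ valLE γ := fun _ hc δ hδ => hc δ hδ.le

theorem valLE_mono {γ γ' : ℝ} (h : γ ≤ γ') : valLE γ ≤ valLE γ' :=
  fun _ hc δ hδ => hc δ (h.trans_lt hδ)

theorem valLE_le_valLT {γ γ' : ℝ} (h : γ < γ') : valLE γ ≤ valLT γ' :=
  fun _ hc δ hδ => hc δ (h.trans_le hδ)

theorem mem_valLT_iff {γ : ℝ} {c : RevHahn} :
    c ∈ valLT γ ↔ c ∈ valLE γ ∧ c.coeff (toDual γ) = 0 := by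
  refine ⟨fun h => ⟨valLT_le_valLE γ h, h γ le_rfl⟩, fun h δ hδ => ?_⟩
  rcases hδ.eq_or_lt with rfl | hδ
  · exact h.2
  · exact h.1 δ hδ

/-- The largest exponent of a nonzero series. -/
def top (c : RevHahn) : ℝ := ofDual c.order

theorem val_of_ne_zero {c : RevHahn} (hc : c ≠ 0) : val c = (top c : WithBot ℝ) := by
  simp [val, hc, top]

@[simp] theorem val_zero : val 0 = ⊥ := by simp [val]

theorem coeff_top_ne_zero {c : RevHahn} (hc : c ≠ 0) : c.coeff (toDual (top c)) ≠ 0 :=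
  fun h => hc (HahnSeries.coeff_order_eq_zero.1 h)

theorem leadingCoeff_eq_coeff_top (c : RevHahn) : c.leadingCoeff = c.coeff (toDual (top c)) :=
  HahnSeries.leadingCoeff_eq

theorem mem_valLE_top (c : RevHahn) : c ∈ valLE (top c) := fun _ hδ =>
  HahnSeries.coeff_eq_zero_of_lt_order (toDual_lt_toDual.2 hδ)

theorem mem_valLE_iff_top_le {c : RevHahn} (hc : c ≠ 0) {γ : ℝ} : c ∈ valLE γ ↔ top c ≤ γ := by
  refine ⟨fun h => ?_, fun h => valLE_mono h (mem_valLE_top c)⟩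
  by_contra! hlt
  exact coeff_top_ne_zero hc (h _ hlt)

theorem mem_valLT_iff_top_lt {c : RevHahn} (hc : c ≠ 0) {γ : ℝ} : c ∈ valLT γ ↔ top c < γ := by
  refine ⟨fun h => ?_, fun h => valLE_le_valLT h (mem_valLE_top c)⟩
  by_contra! hlt
  exact coeff_top_ne_zero hc (h _ hlt)

theorem mem_valLE_iff_val_le {c : RevHahn} {γ : ℝ} : c ∈ valLE γ ↔ val c ≤ (γ : WithBot ℝ) := by
  by_cases hc : c = 0
  · simp [hc]
  · rw [mem_valLE_iff_top_le hc, val_of_ne_zero hc, WithBot.coe_le_coe]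

theorem eq_zero_of_forall_mem_valLE {c : RevHahn} (h : ∀ γ, c ∈ valLE γ) : c = 0 := by
  by_contra hc
  exact absurd ((mem_valLE_iff_top_le hc).1 (h (top c - 1))) (by linarith)

/-- The power `t^γ`. -/
def tpow (γ : ℝ) : RevHahn := HahnSeries.single (toDual γ) 1

theorem tpow_zero : tpow 0 = 1 := rfl

theorem tpow_add (γ δ : ℝ) : tpow (γ + δ) = tpow γ * tpow δ := by
  simp [tpow, HahnSeries.single_mul_single]

theorem tpow_ne_zero (γ : ℝ) : tpow γ ≠ 0 := HahnSeries.single_ne_zero one_ne_zero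

theorem tpow_pow (γ : ℝ) (n : ℕ) : tpow γ ^ n = tpow (n * γ) := by
  rw [tpow, HahnSeries.single_pow, one_pow, tpow, ← nsmul_eq_mul]
  rfl

theorem tpow_mul_tpow_neg (γ : ℝ) : tpow γ * tpow (-γ) = 1 := by
  rw [← tpow_add, add_neg_cancel, tpow_zero]

theorem coeff_tpow (γ δ : ℝ) : (tpow γ).coeff (toDual δ) = if δ = γ then 1 else 0 := by
  simp [tpow, HahnSeries.coeff_single]

theorem coeff_tpow_mul (γ δ : ℝ) (c : RevHahn) :
    (tpow γ * c).coeff (toDual δ) = c.coeff (toDual (δ - γ)) := by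
  have := HahnSeries.coeff_single_mul_add (r := (1 : ℂ)) (x := c) (a := toDual (δ - γ))
    (b := toDual γ)
  rw [one_mul, ← toDual_add, sub_add_cancel] at this
  exact this

theorem tpow_mem_valLE (γ : ℝ) : tpow γ ∈ valLE γ := fun δ hδ => by
  rw [coeff_tpow, if_neg hδ.ne']

theorem tpow_mul_mem_valLE_iff {γ δ : ℝ} {c : RevHahn} :
    tpow γ * c ∈ valLE δ ↔ c ∈ valLE (δ - γ) := by
  simp only [mem_valLE, coeff_tpow_mul]
  refine ⟨fun h ε hε => ?_, fun h ε hε => h _ (by linarith)⟩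
  simpa using h (ε + γ) (by linarith)

theorem mul_mem_valLE {γ δ : ℝ} {c d : RevHahn} (hc : c ∈ valLE γ) (hd : d ∈ valLE δ) :
    c * d ∈ valLE (γ + δ) := by
  by_cases hc0 : c = 0
  · simp [hc0]
  by_cases hd0 : d = 0
  · simp [hd0]
  rw [mem_valLE_iff_top_le (mul_ne_zero hc0 hd0), top, HahnSeries.order_mul hc0 hd0, ofDual_add]
  exact add_le_add ((mem_valLE_iff_top_le hc0).1 hc) ((mem_valLE_iff_top_le hd0).1 hd)

theorem mul_mem_valLT {γ δ : ℝ} {c d : RevHahn} (hc : c ∈ valLE γ) (hd : d ∈ valLT δ) :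
    c * d ∈ valLT (γ + δ) := by
  by_cases hc0 : c = 0
  · simp [hc0]
  by_cases hd0 : d = 0
  · simp [hd0]
  rw [mem_valLT_iff_top_lt (mul_ne_zero hc0 hd0), top, HahnSeries.order_mul hc0 hd0, ofDual_add]
  exact add_lt_add_of_le_of_lt ((mem_valLE_iff_top_le hc0).1 hc) ((mem_valLT_iff_top_lt hd0).1 hd)

theorem coeff_C_mul (r : ℂ) (c : RevHahn) (δ : ℝᵒᵈ) :
    (HahnSeries.C r * c).coeff δ = r * c.coeff δ := by
  rw [HahnSeries.C_mul_eq_smul, HahnSeries.coeff_smul, smul_eq_mul]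

theorem C_mul_mem_valLE (r : ℂ) {γ : ℝ} {c : RevHahn} (hc : c ∈ valLE γ) :
    HahnSeries.C r * c ∈ valLE γ := fun δ hδ => by
  rw [coeff_C_mul, hc δ hδ, mul_zero]

/-- A series of valuation at most `γ` is its `t^γ`-term up to valuation less than `γ`. -/
theorem sub_C_mul_tpow_mem_valLT {γ : ℝ} {c : RevHahn} (hc : c ∈ valLE γ) :
    c - HahnSeries.C (c.coeff (toDual γ)) * tpow γ ∈ valLT γ := by
  refine mem_valLT_iff.2 ⟨sub_mem hc (C_mul_mem_valLE _ (tpow_mem_valLE γ)), ?_⟩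
  simp [coeff_tpow]

/-- Replacing `c` by its `t^γ`-term changes the product only at exponents below `γ + δ`. -/
theorem coeff_mul_of_mem_valLE {γ δ : ℝ} {c d : RevHahn} (hc : c ∈ valLE γ) (hd : d ∈ valLE δ) :
    (c * d).coeff (toDual (γ + δ)) = c.coeff (toDual γ) * d.coeff (toDual δ) := by
  have h := mul_mem_valLT hd (sub_C_mul_tpow_mem_valLT hc) (γ + δ) (by linarith)
  rw [mul_comm, sub_mul, mul_assoc, HahnSeries.coeff_sub, coeff_C_mul,
    coeff_tpow_mul, sub_eq_zero] at h
  simpa using h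

theorem C_mem_valLE (r : ℂ) : (HahnSeries.C r : RevHahn) ∈ valLE 0 := by
  have := C_mul_mem_valLE r (tpow_mem_valLE 0)
  rwa [tpow_zero, mul_one] at this

theorem one_mem_valLE : (1 : RevHahn) ∈ valLE 0 := tpow_mem_valLE 0

end AffineTrop
end

/-! ### Maximal subrings not containing `t`. -/

noncomputable section

namespace AffineTrop

open OrderDual

/-- Lifts of linearly independent reductions are linearly independent. -/
theorem linearIndependent_of_reduction {ι M Q : Type*} [AddCommGroup M] [Module RevHahn M]
    [AddCommGroup Q] [Module ℂ Q] {f : ι → M} {g : ι → Q} (hg : LinearIndependent ℂ g)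
    (h : ∀ (s : Finset ι) (c : ι → RevHahn), (∀ i ∈ s, c i ∈ valLE 0) → ∑ i ∈ s, c i • f i = 0 →
      ∑ i ∈ s, (c i).coeff (toDual 0) • g i = 0) : LinearIndependent RevHahn f := by
  classical
  rw [linearIndependent_iff']
  intro s c hc
  by_contra! hne
  obtain ⟨i, his, hi⟩ := hne
  obtain ⟨j, hj, hmax⟩ := (s.filter (c · ≠ 0)).exists_max_image (fun j => top (c j))
    ⟨i, Finset.mem_filter.2 ⟨his, hi⟩⟩
  obtain ⟨hjs, hj0⟩ := Finset.mem_filter.1 hj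
  -- Scaling by the largest valuation makes all coefficients integral, and the `j`-th one reduces to
  -- a nonzero constant.
  have hsum := h s (fun i => tpow (-top (c j)) * c i) (fun k hk => by
      rw [tpow_mul_mem_valLE_iff]
      by_cases hk0 : c k = 0
      · simp [hk0]
      · rw [mem_valLE_iff_top_le hk0]
        simpa using hmax k (Finset.mem_filter.2 ⟨hk, hk0⟩))
    (by simp only [mul_smul, ← Finset.smul_sum, hc, smul_zero])
  have := linearIndependent_iff'.1 hg s _ hsum j hjs
  rw [coeff_tpow_mul] at this
  simp only [sub_neg_eq_add, zero_add] at this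
  exact coeff_top_ne_zero hj0 this

variable {A : Type*} [CommRing A] [Algebra RevHahn A]

variable (A) in
/-- The image of `t^γ` in a `RevHahn`-algebra. -/
def tpowIn (γ : ℝ) : A := algebraMap RevHahn A (tpow γ)

theorem tpowIn_zero : tpowIn A 0 = 1 := by rw [tpowIn, tpow_zero, map_one]

theorem tpowIn_add (γ δ : ℝ) : tpowIn A (γ + δ) = tpowIn A γ * tpowIn A δ := by
  rw [tpowIn, tpow_add, map_mul]; rfl

theorem tpowIn_pow (γ : ℝ) (n : ℕ) : tpowIn A γ ^ n = tpowIn A (n * γ) := by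
  rw [tpowIn, ← map_pow, tpow_pow]; rfl

/-- A subring containing the valuation ring, not containing `t`, maximal with this property, and
containing a multiple by a power of `t` of every element. It is the unit ball of a minimal
multiplicative seminorm. -/
structure IsMaximalBall (B : Subring A) : Prop where
  algebraMap_mem : ∀ c ∈ valLE 0, algebraMap RevHahn A c ∈ B
  tpowIn_one_notMem : tpowIn A 1 ∉ B
  le_of_le : ∀ B' : Subring A, B ≤ B' → tpowIn A 1 ∉ B' → B' ≤ B
  exists_tpowIn_mul_mem : ∀ a, ∃ γ, tpowIn A γ * a ∈ B

namespace IsMaximalBall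

variable {B : Subring A} (hB : IsMaximalBall B)
include hB

theorem tpowIn_mem {γ : ℝ} (hγ : γ ≤ 0) : tpowIn A γ ∈ B :=
  hB.algebraMap_mem _ (valLE_mono hγ (tpow_mem_valLE γ))

theorem tpowIn_mul_mem_of_le {γ δ : ℝ} (h : γ ≤ δ) {a : A} (ha : tpowIn A δ * a ∈ B) :
    tpowIn A γ * a ∈ B := by
  have := mul_mem (hB.tpowIn_mem (sub_nonpos.2 h)) ha
  rwa [← mul_assoc, ← tpowIn_add, sub_add_cancel] at this

theorem tpowIn_notMem {ε : ℝ} (hε : 0 < ε) : tpowIn A ε ∉ B := fun h => by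
  obtain ⟨n, hn⟩ := exists_nat_ge (1 / ε)
  refine hB.tpowIn_one_notMem ?_
  have h1 : tpowIn A (n * ε) * 1 ∈ B := by
    rw [mul_one, ← tpowIn_pow]; exact pow_mem h n
  have := hB.tpowIn_mul_mem_of_le (γ := 1) (by rwa [div_le_iff₀ hε] at hn) h1
  rwa [mul_one] at this

theorem nontrivial : Nontrivial A := by
  by_contra h
  rw [not_nontrivial_iff_subsingleton] at h
  exact hB.tpowIn_one_notMem (by rw [Subsingleton.elim (tpowIn A 1) 0]; exact zero_mem B)

theorem mem_valLE_zero {c : RevHahn} (hc : algebraMap RevHahn A c ∈ B) : c ∈ valLE 0 := by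
  by_cases hc0 : c = 0
  · simp [hc0]
  rw [mem_valLE_iff_top_le hc0]
  by_contra! hpos
  refine hB.tpowIn_notMem hpos ?_
  have h1 : c * (c⁻¹ * tpow (top c)) = tpow (top c) := by rw [← mul_assoc, mul_inv_cancel₀ hc0,
    one_mul]
  have hd0 : c⁻¹ * tpow (top c) ≠ 0 := mul_ne_zero (inv_ne_zero hc0) (tpow_ne_zero _)
  have h2 : top (c⁻¹ * tpow (top c)) ≤ 0 := by
    have h3 : top (c * (c⁻¹ * tpow (top c))) = top c + top (c⁻¹ * tpow (top c)) := by
      rw [top, HahnSeries.order_mul hc0 hd0, ofDual_add]; rfl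
    have h4 : top (tpow (top c)) = top c := by
      rw [top, tpow, HahnSeries.order_single one_ne_zero, ofDual_toDual]
    rw [h1, h4] at h3
    linarith
  rw [tpowIn, ← h1, map_mul]
  exact mul_mem hc (hB.algebraMap_mem _ ((mem_valLE_iff_top_le hd0).2 h2))

theorem mem_valLE_of_tpowIn_neg_mul_mem {c : RevHahn} {γ : ℝ}
    (hc : tpowIn A (-γ) * algebraMap RevHahn A c ∈ B) : c ∈ valLE γ := by
  rw [tpowIn, ← map_mul] at hc
  have := hB.mem_valLE_zero hc
  rwa [tpow_mul_mem_valLE_iff, zero_sub, neg_neg] at this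

theorem tpowIn_neg_mul_algebraMap_mem {c : RevHahn} {γ : ℝ} (hc : c ∈ valLE γ) :
    tpowIn A (-γ) * algebraMap RevHahn A c ∈ B := by
  rw [tpowIn, ← map_mul]
  exact hB.algebraMap_mem _ (by rwa [tpow_mul_mem_valLE_iff, zero_sub, neg_neg])

/-- The unit ball is closed: the elements satisfying the hypothesis form a ring containing `B`, and
this ring misses `t` since otherwise `t^(1/2)` would lie in `B`. Maximality then applies. -/
theorem mem_of_forall_pos {a : A} (ha : ∀ ε > 0, tpowIn A (-ε) * a ∈ B) : a ∈ B := by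
  let B' : Subring A :=
    { carrier := {a | ∀ ε > 0, tpowIn A (-ε) * a ∈ B}
      mul_mem' := fun {a b} ha hb ε hε => by
        have := mul_mem (ha (ε / 2) (half_pos hε)) (hb (ε / 2) (half_pos hε))
        rwa [mul_mul_mul_comm, ← tpowIn_add, ← neg_add, add_halves] at this
      one_mem' := fun ε hε => by rw [mul_one]; exact hB.tpowIn_mem (by linarith)
      add_mem' := fun ha hb ε hε => by rw [mul_add]; exact add_mem (ha ε hε) (hb ε hε)
      zero_mem' := fun ε hε => by rw [mul_zero]; exact zero_mem B
      neg_mem' := fun ha ε hε => by rw [mul_neg]; exact neg_mem (ha ε hε) }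
  refine hB.le_of_le B' (fun b hb ε hε => mul_mem (hB.tpowIn_mem (by linarith)) hb) ?_ ha
  intro h
  have := h (1 / 2) (by norm_num)
  rw [← tpowIn_add] at this
  exact hB.tpowIn_notMem (by norm_num) this

/-- Multiplying an integral equation of degree `m + 1` by `t^(-m)` expresses `t` through the
`t^(i-m)` with `i ≤ m`, all of which lie in `B`. -/
theorem not_isIntegral_tpowIn_one : ¬ IsIntegral B (tpowIn A 1) := by
  rintro ⟨p, hp, hp0⟩
  have := hB.nontrivial
  refine hB.tpowIn_one_notMem ?_
  rcases Nat.eq_zero_or_pos p.natDegree with h0 | hpos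
  · rw [hp.natDegree_eq_zero.1 h0, Polynomial.eval₂_one] at hp0
    exact absurd hp0 one_ne_zero
  obtain ⟨m, hm⟩ : ∃ m, p.natDegree = m + 1 := ⟨p.natDegree - 1, by omega⟩
  rw [Polynomial.eval₂_eq_sum_range, Finset.sum_range_succ, hp.coeff_natDegree, map_one, one_mul,
    hm] at hp0
  have h1 : tpowIn A 1 = tpowIn A (-m) * tpowIn A 1 ^ (m + 1) := by
    rw [tpowIn_pow, ← tpowIn_add]; congr 1; push_cast; ring
  rw [h1, eq_neg_of_add_eq_zero_right hp0, mul_neg, Finset.mul_sum]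
  refine neg_mem (sum_mem fun i hi => ?_)
  rw [mul_left_comm]
  refine mul_mem (p.coeff i).2 ?_
  rw [tpowIn_pow, ← tpowIn_add]
  refine hB.tpowIn_mem ?_
  have : (i : ℝ) ≤ m := by exact_mod_cast Nat.lt_succ_iff.1 (Finset.mem_range.1 hi)
  linarith

theorem tpowIn_one_mem_adjoin {a : A} (ha : a ∉ B) : tpowIn A 1 ∈ Algebra.adjoin B {a} := by
  by_contra h
  refine ha (hB.le_of_le (Algebra.adjoin B {a}).toSubring (fun b hb => ?_) h
    (Algebra.self_mem_adjoin_singleton B a))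
  exact (Algebra.adjoin B {a}).algebraMap_mem ⟨b, hb⟩

/-- Otherwise maximality puts `t` in `B[a]`, which is integral over `B`. -/
theorem mem_of_isIntegral {a : A} (ha : IsIntegral B a) : a ∈ B := by
  by_contra h
  have := adjoin_le_integralClosure ha (hB.tpowIn_one_mem_adjoin h)
  exact hB.not_isIntegral_tpowIn_one this

theorem mem_of_pow_mem {a : A} {n : ℕ} (hn : 0 < n) (ha : a ^ n ∈ B) : a ∈ B :=
  hB.mem_of_isIntegral (IsIntegral.of_pow hn
    (isIntegral_algebraMap (R := B) (A := A) (x := ⟨a ^ n, ha⟩)))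

/-- Elements of norm one can be cancelled. -/
theorem mem_of_mul_mem {a g : A} (ha : a ∈ B) (ha' : ∀ ε > 0, tpowIn A ε * a ∉ B)
    (hg : g * a ∈ B) : g ∈ B := by
  have key : ∀ {g : A} {k l : ℕ}, k ≤ l → g * a ^ k ∈ B → g * a ^ l ∈ B := fun {g k l} hkl h => by
    obtain ⟨m, rfl⟩ := Nat.exists_eq_add_of_le hkl
    rw [pow_add, ← mul_assoc]
    exact mul_mem h (pow_mem ha m)
  -- Localize at `a`. If `t * a^k` were in `B`, so would be `t * a^(k+1)`, the `(k+1)`-st power of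
  -- `t^(1/(k+1)) * a`; taking the root contradicts that `a` has norm one. The shift to `k + 1`
  -- covers `k = 0`.
  let B' : Subring A :=
    { carrier := {g | ∃ k : ℕ, g * a ^ k ∈ B}
      mul_mem' := fun {g h} ⟨k, hk⟩ ⟨l, hl⟩ => ⟨k + l, by
        rw [pow_add, mul_mul_mul_comm]; exact mul_mem hk hl⟩
      one_mem' := ⟨0, by simp [one_mem]⟩
      add_mem' := fun {g h} ⟨k, hk⟩ ⟨l, hl⟩ => ⟨max k l, by
        rw [add_mul]
        exact add_mem (key (le_max_left _ _) hk) (key (le_max_right _ _) hl)⟩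
      zero_mem' := ⟨0, by simp [zero_mem]⟩
      neg_mem' := fun {g} ⟨k, hk⟩ => ⟨k, by rw [neg_mul]; exact neg_mem hk⟩ }
  refine hB.le_of_le B' (fun b hb => ⟨0, by simpa using hb⟩) ?_ ⟨1, by simpa using hg⟩
  rintro ⟨k, hk⟩
  have hk' := key (Nat.le_succ k) hk
  refine ha' (1 / (k + 1 : ℕ)) (by positivity) (hB.mem_of_pow_mem k.succ_pos ?_)
  rw [mul_pow, tpowIn_pow, mul_one_div_cancel (by positivity)]
  exact hk'

/-- An element of norm one is invertible up to norm less than one. As `t * a` is not in `B`, one can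
write `t = p(t * a)` with `p` over `B`; splitting off the constant term of `p` gives `t * (1 - a *
q) ∈ B`, and cancelling `a` puts `q` in `B`. -/
theorem exists_one_sub_mul {a : A} (ha : a ∈ B) (ha' : ∀ ε > 0, tpowIn A ε * a ∉ B) :
    ∃ b ∈ B, tpowIn A 1 * (1 - a * b) ∈ B := by
  have h := hB.tpowIn_one_mem_adjoin (ha' 1 one_pos)
  rw [Algebra.adjoin_singleton_eq_range_aeval] at h
  obtain ⟨p, hp⟩ := h
  set q := Polynomial.aeval (tpowIn A 1 * a) p.divX with hq
  have h1 : tpowIn A 1 * (1 - a * q) = p.coeff 0 := by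
    have h2 : Polynomial.aeval (tpowIn A 1 * a) p = tpowIn A 1 * a * q + p.coeff 0 := by
      conv_lhs => rw [← Polynomial.X_mul_divX_add p]
      rw [map_add, map_mul, Polynomial.aeval_X, Polynomial.aeval_C]
      rfl
    have h3 : tpowIn A 1 = tpowIn A 1 * a * q + p.coeff 0 := hp.symm.trans h2
    linear_combination h3
  have h4 : tpowIn A 1 * (1 - a * q) ∈ B := h1 ▸ (p.coeff 0).2
  refine ⟨q, hB.mem_of_mul_mem ha ha' ?_, h4⟩
  have h5 : 1 - a * q ∈ B := by
    simpa [tpowIn_zero] using hB.tpowIn_mul_mem_of_le zero_le_one h4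
  have h6 := sub_mem (one_mem B) h5
  rwa [sub_sub_cancel, mul_comm] at h6

end IsMaximalBall

end AffineTrop
end

/-! ### From a maximal subring to a point over the Hahn field. -/

noncomputable section

namespace AffineTrop

open OrderDual

variable {A : Type*} [CommRing A] [Algebra RevHahn A]

/-- The copy of the complex numbers in a `RevHahn`-algebra. -/
def constIn (A : Type*) [CommRing A] [Algebra RevHahn A] : ℂ →+* A :=
  (algebraMap RevHahn A).comp HahnSeries.C

namespace IsMaximalBall

variable {B : Subring A} (hB : IsMaximalBall B)
include hB

theorem constIn_mem (r : ℂ) : constIn A r ∈ B := hB.algebraMap_mem _ (C_mem_valLE r)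

/-- The ideal of elements of norm less than one. -/
def maxIdeal : Ideal B where
  carrier := {b | ∃ ε > 0, tpowIn A ε * b ∈ B}
  add_mem' := by
    rintro a b ⟨ε, hε, ha⟩ ⟨δ, hδ, hb⟩
    refine ⟨min ε δ, lt_min hε hδ, ?_⟩
    rw [Subring.coe_add, mul_add]
    exact add_mem (hB.tpowIn_mul_mem_of_le (min_le_left _ _) ha)
      (hB.tpowIn_mul_mem_of_le (min_le_right _ _) hb)
  zero_mem' := ⟨1, one_pos, by simp [zero_mem]⟩
  smul_mem' := by
    rintro c b ⟨ε, hε, hb⟩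
    refine ⟨ε, hε, ?_⟩
    rw [smul_eq_mul, Subring.coe_mul, mul_left_comm]
    exact mul_mem c.2 hb

theorem isMaximal_maxIdeal : hB.maxIdeal.IsMaximal := by
  refine Ideal.isMaximal_iff.2 ⟨?_, fun J a hJ ha haJ => ?_⟩
  · rintro ⟨ε, hε, h⟩
    exact hB.tpowIn_notMem hε (by simpa using h)
  · obtain ⟨b, hb, h⟩ := hB.exists_one_sub_mul a.2 (fun ε hε h => ha ⟨ε, hε, h⟩)
    have h1 : (1 - a * ⟨b, hb⟩ : B) ∈ J := hJ ⟨1, one_pos, by simpa using h⟩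
    have h2 := J.add_mem h1 (J.mul_mem_right ⟨b, hb⟩ haJ)
    rwa [sub_add_cancel] at h2

/-- The constants, as elements of the unit ball. -/
def const : ℂ →+* B := (constIn A).codRestrict B hB.constIn_mem

/-- If the algebra has countable dimension, the residue field is `ℂ`. -/
theorem exists_sub_const_mem (hA : Module.rank RevHahn A ≤ Cardinal.aleph0) (b : B) :
    ∃ r : ℂ, b - hB.const r ∈ hB.maxIdeal := by
  have := hB.isMaximal_maxIdeal
  let _ : Field (B ⧸ hB.maxIdeal) := Ideal.Quotient.field _
  let _ : Algebra ℂ (B ⧸ hB.maxIdeal) :=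
    ((Ideal.Quotient.mk hB.maxIdeal).comp hB.const).toAlgebra
  have hsmul : ∀ (r : ℂ) (b : B), r • Ideal.Quotient.mk hB.maxIdeal b =
      Ideal.Quotient.mk hB.maxIdeal (hB.const r * b) := fun r b => by
    rw [Algebra.smul_def, map_mul]; rfl
  have halg : Algebra.IsAlgebraic ℂ (B ⧸ hB.maxIdeal) := by
    -- For transcendental `x` the inverses of `x - r`, `r ∈ ℂ`, are independent over `ℂ`; their
    -- lifts are independent over `RevHahn`, which contradicts countable dimension.
    refine ⟨fun x => by_contra fun hx => ?_⟩
    have hli := Transcendental.linearIndependent_sub_inv hx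
    choose s hs using fun r : ℂ => Ideal.Quotient.mk_surjective (x - algebraMap ℂ _ r)⁻¹
    have hli' : LinearIndependent RevHahn fun r : ℂ => (s r : A) := by
      refine linearIndependent_of_reduction hli fun u c hc hsum => ?_
      have h1 : ∑ r ∈ u, hB.const ((c r).coeff (toDual 0)) * s r ∈ hB.maxIdeal := by
        classical
        -- An integral coefficient minus its constant term has negative valuation, so it maps into
        -- the maximal ideal and may be replaced by that constant term.
        have h2 : ∀ r ∈ u, ∃ ε > 0, tpowIn A ε * algebraMap RevHahn A
            (c r - HahnSeries.C ((c r).coeff (toDual 0))) ∈ B := fun r hr => by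
          have h3 := sub_C_mul_tpow_mem_valLT (hc r hr)
          rw [tpow_zero, mul_one] at h3
          by_cases h0 : c r - HahnSeries.C ((c r).coeff (toDual 0)) = 0
          · exact ⟨1, one_pos, by rw [h0, map_zero, mul_zero]; exact zero_mem B⟩
          · refine ⟨-top _, neg_pos.2 ((mem_valLT_iff_top_lt h0).1 h3),
              hB.tpowIn_neg_mul_algebraMap_mem (mem_valLE_top _)⟩
        have h4 : ∀ r, ∃ d : B, r ∈ u → d ∈ hB.maxIdeal ∧
            (d : A) = algebraMap RevHahn A (c r - HahnSeries.C ((c r).coeff (toDual 0))) :=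
          fun r => by
            by_cases hr : r ∈ u
            · exact ⟨⟨_, hB.algebraMap_mem _ (sub_mem (hc r hr) (C_mem_valLE _))⟩,
                fun _ => ⟨h2 r hr, rfl⟩⟩
            · exact ⟨0, fun h => absurd h hr⟩
        choose d hd using h4
        have h5 : ∑ r ∈ u, hB.const ((c r).coeff (toDual 0)) * s r = -∑ r ∈ u, d r * s r := by
          rw [eq_neg_iff_add_eq_zero, ← Finset.sum_add_distrib]
          apply Subtype.ext
          rw [AddSubmonoidClass.coe_finsetSum, Subring.coe_zero, ← hsum]
          refine Finset.sum_congr rfl fun r hr => ?_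
          rw [Subring.coe_add, Subring.coe_mul, Subring.coe_mul, (hd r hr).2, map_sub,
            Algebra.smul_def]
          change algebraMap RevHahn A _ * _ + _ = _
          ring
        rw [h5]
        exact neg_mem (sum_mem fun r hr => Ideal.mul_mem_right _ _ (hd r hr).1)
      rw [← Ideal.Quotient.eq_zero_iff_mem, map_sum] at h1
      rw [← h1]
      exact Finset.sum_congr rfl fun r _ => by rw [← hs r, hsmul]
    have hcard := hli'.cardinal_lift_le_rank
    have h2 := hcard.trans (Cardinal.lift_le.2 hA)
    rw [Cardinal.lift_aleph0, Cardinal.mk_complex, Cardinal.lift_continuum] at h2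
    exact absurd h2 (not_le.2 Cardinal.aleph0_lt_continuum)
  obtain ⟨r, hr⟩ := (IsAlgClosed.algebraMap_bijective_of_isIntegral
    (k := ℂ) (K := B ⧸ hB.maxIdeal)).2 (Ideal.Quotient.mk _ b)
  exact ⟨r, Ideal.Quotient.eq.1 hr.symm⟩

/-- The maximal completeness of `RevHahn`: the elements approximating `a` have a limit. -/
theorem exists_best_approx (a : A) : ∃ c : RevHahn, ∀ (c' : RevHahn) (γ : ℝ),
    tpowIn A (-γ) * (a - algebraMap RevHahn A c') ∈ B →
    tpowIn A (-γ) * (a - algebraMap RevHahn A c) ∈ B := by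
  classical
  have huniq : ∀ {c c' : RevHahn} {γ γ' δ : ℝ}, γ < δ → γ' < δ →
      tpowIn A (-γ) * (a - algebraMap RevHahn A c) ∈ B →
      tpowIn A (-γ') * (a - algebraMap RevHahn A c') ∈ B →
      c.coeff (toDual δ) = c'.coeff (toDual δ) := fun {c c' γ γ' δ} h h' hc hc' => by
    have h1 := hB.tpowIn_mul_mem_of_le (neg_le_neg (le_max_left γ γ')) hc
    have h2 := hB.tpowIn_mul_mem_of_le (neg_le_neg (le_max_right γ γ')) hc'
    have h3 := sub_mem h2 h1
    rw [← mul_sub, sub_sub_sub_cancel_left, ← map_sub] at h3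
    have h4 := hB.mem_valLE_of_tpowIn_neg_mul_mem h3 δ (max_lt h h')
    rwa [HahnSeries.coeff_sub, sub_eq_zero] at h4
  -- Two approximations of `a` with error below `δ` have the same coefficient at `δ`; the limit
  -- takes this common value, and `0` where no such approximation exists.
  let φ : ℝ → ℂ := fun δ =>
    if h : ∃ c : RevHahn, ∃ γ < δ, tpowIn A (-γ) * (a - algebraMap RevHahn A c) ∈ B
    then h.choose.coeff (toDual δ) else 0
  have hφ : ∀ {c : RevHahn} {γ δ : ℝ}, γ < δ →
      tpowIn A (-γ) * (a - algebraMap RevHahn A c) ∈ B → φ δ = c.coeff (toDual δ) :=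
    fun {c γ δ} h hc => by
      have hex : ∃ c : RevHahn, ∃ γ < δ, tpowIn A (-γ) * (a - algebraMap RevHahn A c) ∈ B :=
        ⟨c, γ, h, hc⟩
      obtain ⟨γ', h', hc'⟩ := hex.choose_spec
      rw [← huniq h' h hc' hc]
      exact dif_pos hex
  have hwf : (Function.support fun δ : ℝᵒᵈ => φ (ofDual δ)).IsWF := by
    -- One series approximates `a` with error below the first exponent of such a sequence, so its
    -- support would contain the whole sequence.
    refine Set.wellFoundedOn_iff_no_descending_seq.2 fun f hf => ?_
    have h0 : φ (ofDual (f 0)) ≠ 0 := hf 0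
    obtain ⟨c, γ, hγ, hc⟩ : ∃ c : RevHahn, ∃ γ < ofDual (f 0),
        tpowIn A (-γ) * (a - algebraMap RevHahn A c) ∈ B := by
      by_contra h
      exact h0 (dif_neg h)
    refine Set.wellFoundedOn_iff_no_descending_seq.1 c.isWF_support f fun n => ?_
    have hn : ofDual (f 0) ≤ ofDual (f n) := by
      rcases Nat.eq_zero_or_pos n with rfl | hn
      · exact le_rfl
      · exact (f.map_rel_iff.2 hn : f n < f 0).le
    have := hf n
    rw [Function.mem_support, hφ (hγ.trans_le hn) hc] at this
    exact this
  refine ⟨⟨fun δ => φ (ofDual δ), hwf.isPWO⟩, fun c' γ hc' => ?_⟩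
  set c : RevHahn := ⟨fun δ => φ (ofDual δ), hwf.isPWO⟩
  have h1 : c' - c ∈ valLE γ := fun δ hδ => by
    rw [HahnSeries.coeff_sub, ← hφ hδ hc']
    exact sub_self _
  have h2 := add_mem hc' (hB.tpowIn_neg_mul_algebraMap_mem h1)
  rwa [← mul_add, map_sub, sub_add_sub_cancel] at h2

/-- The elements of norm zero. -/
def kernel : Ideal A where
  carrier := {a | ∀ γ, tpowIn A γ * a ∈ B}
  add_mem' ha hb γ := by rw [mul_add]; exact add_mem (ha γ) (hb γ)
  zero_mem' γ := by rw [mul_zero]; exact zero_mem B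
  smul_mem' := by
    intro b a ha γ
    obtain ⟨δ, hδ⟩ := hB.exists_tpowIn_mul_mem b
    have := mul_mem (ha (γ - δ)) hδ
    rwa [mul_mul_mul_comm, ← tpowIn_add, sub_add_cancel, mul_comm a] at this

/-- If the error `e` of a best approximation had nonzero norm, scaling it to norm one and
subtracting its residue, a constant `r`, would give a strictly better approximation. -/
theorem exists_sub_algebraMap_mem_kernel (hA : Module.rank RevHahn A ≤ Cardinal.aleph0) (a : A) :
    ∃ c : RevHahn, a - algebraMap RevHahn A c ∈ hB.kernel := by
  obtain ⟨c, hc⟩ := hB.exists_best_approx a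
  refine ⟨c, ?_⟩
  set e := a - algebraMap RevHahn A c with he
  by_contra hne
  obtain ⟨γ₁, hγ₁⟩ : ∃ γ, tpowIn A γ * e ∉ B := by
    by_contra! h
    exact hne h
  obtain ⟨γ₂, hγ₂⟩ := hB.exists_tpowIn_mul_mem e
  set S := {γ | tpowIn A γ * e ∈ B} with hS
  have hbdd : BddAbove S := ⟨γ₁, fun γ hγ => by
    by_contra! h
    exact hγ₁ (hB.tpowIn_mul_mem_of_le h.le hγ)⟩
  -- The supremum is attained because the unit ball is closed.
  have hmem : tpowIn A (sSup S) * e ∈ B := hB.mem_of_forall_pos fun ε hε => by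
    obtain ⟨γ, hγ, hlt⟩ := exists_lt_of_lt_csSup ⟨γ₂, hγ₂⟩ (sub_lt_self (sSup S) hε)
    rw [← mul_assoc, ← tpowIn_add]
    exact hB.tpowIn_mul_mem_of_le (by linarith) hγ
  obtain ⟨r, ε, hε, hr⟩ := hB.exists_sub_const_mem hA ⟨_, hmem⟩
  have h1 : tpowIn A (-(-(sSup S + ε))) *
      (a - algebraMap RevHahn A (c + HahnSeries.C r * tpow (-sSup S))) ∈ B := by
    convert hr using 1
    change _ = tpowIn A ε * (tpowIn A (sSup S) * e - algebraMap RevHahn A (HahnSeries.C r))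
    have h3 : tpowIn A (sSup S) * algebraMap RevHahn A (tpow (-sSup S)) = 1 := by
      rw [tpowIn, ← map_mul, tpow_mul_tpow_neg, map_one]
    rw [neg_neg, tpowIn_add, map_add, map_mul, he]
    linear_combination (-tpowIn A ε * algebraMap RevHahn A (HahnSeries.C r)) * h3
  have h2 := hc _ _ h1
  rw [neg_neg] at h2
  linarith [le_csSup hbdd (show sSup S + ε ∈ S from h2)]

theorem exists_algHom (hA : Module.rank RevHahn A ≤ Cardinal.aleph0) :
    ∃ φ : A →ₐ[RevHahn] RevHahn, ∀ b ∈ B, φ b ∈ valLE 0 := by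
  have hker : ∀ c, algebraMap RevHahn A c ∈ hB.kernel → c = 0 := fun c hc =>
    eq_zero_of_forall_mem_valLE fun γ => hB.mem_valLE_of_tpowIn_neg_mul_mem (hc (-γ))
  have hbij : Function.Bijective (Algebra.ofId RevHahn (A ⧸ hB.kernel)) := by
    refine ⟨(injective_iff_map_eq_zero _).2 fun c hc => hker c ?_, fun x => ?_⟩
    · exact Ideal.Quotient.eq_zero_iff_mem.1 hc
    · obtain ⟨a, rfl⟩ := Ideal.Quotient.mk_surjective x
      obtain ⟨c, hc⟩ := hB.exists_sub_algebraMap_mem_kernel hA a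
      exact ⟨c, (Ideal.Quotient.eq.2 hc).symm⟩
  let e := AlgEquiv.ofBijective _ hbij
  refine ⟨e.symm.toAlgHom.comp (Ideal.Quotient.mkₐ RevHahn hB.kernel), fun b hb => ?_⟩
  obtain ⟨c, hc⟩ := hB.exists_sub_algebraMap_mem_kernel hA b
  have h1 : e c = Ideal.Quotient.mkₐ RevHahn hB.kernel b := (Ideal.Quotient.eq.2 hc).symm
  have h2 : (e.symm.toAlgHom.comp (Ideal.Quotient.mkₐ RevHahn hB.kernel)) b = c := by
    change e.symm (Ideal.Quotient.mkₐ RevHahn hB.kernel b) = c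
    rw [← h1, AlgEquiv.symm_apply_apply]
  rw [h2]
  apply hB.mem_valLE_zero
  have h3 := hc 0
  rw [tpowIn_zero, one_mul] at h3
  simpa using sub_mem hb h3

end IsMaximalBall

/-- A subring containing the valuation ring but not `t` lies in the unit ball of a point. -/
theorem exists_algHom_of_tpowIn_one_notMem (hA : Module.rank RevHahn A ≤ Cardinal.aleph0)
    (B₀ : Subring A) (hO : ∀ c ∈ valLE 0, algebraMap RevHahn A c ∈ B₀) (ht : tpowIn A 1 ∉ B₀)
    (habs : ∀ a, ∃ γ, tpowIn A γ * a ∈ B₀) :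
    ∃ φ : A →ₐ[RevHahn] RevHahn, ∀ b ∈ B₀, φ b ∈ valLE 0 := by
  obtain ⟨B, hle, hmax⟩ := zorn_le_nonempty₀ {B : Subring A | tpowIn A 1 ∉ B}
    (fun c hc hchain B hBc => ⟨sSup c, fun h => by
      rw [Subring.mem_sSup_of_directedOn ⟨B, hBc⟩ hchain.directedOn] at h
      obtain ⟨B', hB', h⟩ := h
      exact hc hB' h, fun B' hB' => le_sSup hB'⟩) B₀ ht
  have hB : IsMaximalBall B :=
    ⟨fun c hc => hle (hO c hc), hmax.prop, fun B' hBB' hB' => hmax.le_of_ge hB' hBB',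
      fun a => (habs a).imp fun γ h => hle h⟩
  obtain ⟨φ, hφ⟩ := hB.exists_algHom hA
  exact ⟨φ, fun b hb => hφ b (hle hb)⟩

end AffineTrop
end

/-! ### Weights, initial forms and initial ideals. -/

noncomputable section

namespace AffineTrop

open OrderDual MvPolynomial

variable {n : ℕ}

/-- The polynomials `f` with `ν_α(f) ≤ γ`. -/
def ball (α γ : ℝ) : AddSubgroup (MvPolynomial (Fin n) RevHahn) where
  carrier := {f | ∀ u, f.coeff u ∈ valLE (γ - α * (u.degree : ℝ))}
  add_mem' hf hg u := by rw [coeff_add]; exact add_mem (hf u) (hg u)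
  zero_mem' u := by rw [coeff_zero]; exact zero_mem _
  neg_mem' hf u := by rw [coeff_neg]; exact neg_mem (hf u)

theorem ball_mono (α : ℝ) {γ γ' : ℝ} (h : γ ≤ γ') : ball (n := n) α γ ≤ ball α γ' :=
  fun _ hf u => valLE_mono (by linarith) (hf u)

theorem coeff_sum_monomial_coeff (α γ : ℝ) (f : MvPolynomial (Fin n) RevHahn) (v : Fin n →₀ ℕ) :
    coeff v (∑ u ∈ f.support,
      monomial u ((f.coeff u).coeff (toDual (γ - α * (u.degree : ℝ))))) =
      (f.coeff v).coeff (toDual (γ - α * (v.degree : ℝ))) := by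
  simp only [coeff_sum, coeff_monomial, Finset.sum_ite_eq']
  split_ifs with h
  · rfl
  · rw [notMem_support_iff.1 h, HahnSeries.coeff_zero]

/-- The part of weight `γ` of a polynomial, where `t^δ x^u` has weight `δ + α|u|`. -/
def slice (α γ : ℝ) : MvPolynomial (Fin n) RevHahn →+ MvPolynomial (Fin n) ℂ where
  toFun f := ∑ u ∈ f.support,
    monomial u ((f.coeff u).coeff (toDual (γ - α * (u.degree : ℝ))))
  map_zero' := by simp
  map_add' f g := by
    ext v
    rw [coeff_add, coeff_sum_monomial_coeff, coeff_sum_monomial_coeff, coeff_sum_monomial_coeff,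
      coeff_add, HahnSeries.coeff_add]

theorem slice_eq_sum (α γ : ℝ) (f : MvPolynomial (Fin n) RevHahn) : slice α γ f =
    ∑ u ∈ f.support, monomial u ((f.coeff u).coeff (toDual (γ - α * (u.degree : ℝ)))) := rfl

theorem coeff_slice (α γ : ℝ) (f : MvPolynomial (Fin n) RevHahn) (v : Fin n →₀ ℕ) :
    coeff v (slice α γ f) = (f.coeff v).coeff (toDual (γ - α * (v.degree : ℝ))) :=
  coeff_sum_monomial_coeff α γ f v

theorem slice_eq_zero_of_lt {α γ γ' : ℝ} (h : γ < γ') {f : MvPolynomial (Fin n) RevHahn}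
    (hf : f ∈ ball α γ) : slice α γ' f = 0 := by
  ext v
  rw [coeff_slice, hf v _ (by linarith), coeff_zero]

theorem mul_mem_ball {α γ δ : ℝ} {f g : MvPolynomial (Fin n) RevHahn} (hf : f ∈ ball α γ)
    (hg : g ∈ ball α δ) : f * g ∈ ball α (γ + δ) := fun u => by
  rw [coeff_mul]
  refine sum_mem fun x hx => ?_
  have h := mul_mem_valLE (hf x.1) (hg x.2)
  rw [Finset.HasAntidiagonal.mem_antidiagonal] at hx
  convert h using 1
  rw [← hx, map_add]
  push_cast
  congr 1
  ring

theorem slice_mul {α γ δ : ℝ} {f g : MvPolynomial (Fin n) RevHahn} (hf : f ∈ ball α γ)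
    (hg : g ∈ ball α δ) : slice α (γ + δ) (f * g) = slice α γ f * slice α δ g := by
  ext u
  rw [coeff_slice, coeff_mul, coeff_mul, HahnSeries.coeff_sum]
  refine Finset.sum_congr rfl fun x hx => ?_
  rw [Finset.HasAntidiagonal.mem_antidiagonal] at hx
  rw [coeff_slice, coeff_slice, ← coeff_mul_of_mem_valLE (hf x.1) (hg x.2)]
  congr 2
  rw [← hx, map_add]
  push_cast
  ring

theorem C_mem_ball (α : ℝ) {γ : ℝ} {c : RevHahn} (hc : c ∈ valLE γ) :
    (C c : MvPolynomial (Fin n) RevHahn) ∈ ball α γ := fun u => by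
  rw [coeff_C]
  split_ifs with h
  · simpa [← h] using hc
  · exact zero_mem _

theorem slice_C (α γ : ℝ) (c : RevHahn) :
    slice α γ (C c : MvPolynomial (Fin n) RevHahn) = C (c.coeff (toDual γ)) := by
  ext u
  rw [coeff_slice, coeff_C, coeff_C]
  split_ifs with h
  · simp [← h]
  · simp

theorem X_mem_ball (α : ℝ) (i : Fin n) : (X i : MvPolynomial (Fin n) RevHahn) ∈ ball α α :=
  fun u => by
  rw [coeff_X]
  split_ifs with h
  · simpa [← h] using one_mem_valLE
  · exact zero_mem _

theorem slice_X (α : ℝ) (i : Fin n) :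
    slice α α (X i : MvPolynomial (Fin n) RevHahn) = X i := by
  ext u
  rw [coeff_slice, coeff_X, coeff_X]
  split_ifs with h
  · rw [← h]
    simp [HahnSeries.coeff_one]
  · simp

theorem exists_mem_ball_slice_ne_zero (α : ℝ) {f : MvPolynomial (Fin n) RevHahn} (hf : f ≠ 0) :
    ∃ γ, f ∈ ball α γ ∧ slice α γ f ≠ 0 := by
  obtain ⟨u, hu, hmax⟩ := f.support.exists_max_image
    (fun u => top (f.coeff u) + α * (u.degree : ℝ)) (support_nonempty.2 hf)
  refine ⟨top (f.coeff u) + α * (u.degree : ℝ), fun v => ?_, fun h => ?_⟩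
  · by_cases hv : f.coeff v = 0
    · rw [hv]; exact zero_mem _
    · rw [mem_valLE_iff_top_le hv]
      linarith [hmax v (mem_support_iff.2 hv)]
  · have h1 := congrArg (coeff u) h
    rw [coeff_slice, coeff_zero, add_sub_cancel_right] at h1
    exact coeff_top_ne_zero (mem_support_iff.1 hu) h1

theorem termVal_of_ne_zero (α : ℝ) {f : MvPolynomial (Fin n) RevHahn} {u : Fin n →₀ ℕ}
    (hu : f.coeff u ≠ 0) :
    termVal α f u = ((top (f.coeff u) + α * (u.degree : ℝ) : ℝ) : WithBot ℝ) := by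
  rw [termVal, val_of_ne_zero hu, WithBot.coe_add]

/-- A nonzero slice at a weight bounding `f` certifies that this weight is `ν_α(f)`. Initial forms
can then be handled through `slice`, which is additive and, on balls, multiplicative. -/
theorem initForm_eq_slice {α γ : ℝ} {f : MvPolynomial (Fin n) RevHahn} (hf : f ∈ ball α γ)
    (h0 : slice α γ f ≠ 0) : initForm α f = slice α γ f := by
  classical
  have hle : ∀ u, f.coeff u ≠ 0 → top (f.coeff u) + α * (u.degree : ℝ) ≤ γ := fun u hu => by
    linarith [(mem_valLE_iff_top_le hu).1 (hf u)]
  have heq : ∀ u, coeff u (slice α γ f) ≠ 0 → f.coeff u ≠ 0 ∧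
      top (f.coeff u) + α * (u.degree : ℝ) = γ := fun u hu => by
    rw [coeff_slice] at hu
    have hu0 : f.coeff u ≠ 0 := HahnSeries.ne_zero_of_coeff_ne_zero hu
    refine ⟨hu0, le_antisymm (hle u hu0) ?_⟩
    by_contra! hlt
    exact hu (mem_valLE_top _ _ (by linarith))
  have hpoly : polyVal α f = (γ : WithBot ℝ) := by
    refine le_antisymm (Finset.sup_le fun u hu => ?_) ?_
    · rw [termVal_of_ne_zero α (mem_support_iff.1 hu), WithBot.coe_le_coe]
      exact hle u (mem_support_iff.1 hu)
    · obtain ⟨u, hu⟩ := ne_zero_iff.1 h0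
      obtain ⟨hu0, hu1⟩ := heq u hu
      rw [← hu1, ← termVal_of_ne_zero α hu0]
      exact Finset.le_sup (mem_support_iff.2 hu0)
  ext v
  simp only [initForm, coeff_sum, coeff_monomial, Finset.sum_ite_eq', Finset.mem_filter,
    mem_support_iff]
  rw [hpoly]
  split_ifs with h
  · rw [termVal_of_ne_zero α h.1, WithBot.coe_inj] at h
    rw [leadingCoeff_eq_coeff_top, coeff_slice, ← h.2, add_sub_cancel_right]
  · by_contra hne
    obtain ⟨h1, h2⟩ := heq v (Ne.symm hne)
    exact h ⟨h1, by rw [termVal_of_ne_zero α h1, h2]⟩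

theorem initForm_zero (α : ℝ) : initForm α (0 : MvPolynomial (Fin n) RevHahn) = 0 := by
  simp [initForm]

theorem initForm_ne_zero (α : ℝ) {f : MvPolynomial (Fin n) RevHahn} (hf : f ≠ 0) :
    initForm α f ≠ 0 := by
  obtain ⟨γ, h, h0⟩ := exists_mem_ball_slice_ne_zero α hf
  rwa [initForm_eq_slice h h0]

theorem coeff_initForm_eq_zero (α : ℝ) {f : MvPolynomial (Fin n) RevHahn} {u : Fin n →₀ ℕ}
    (hu : f.coeff u = 0) : coeff u (initForm α f) = 0 := by
  by_cases hf : f = 0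
  · rw [hf, initForm_zero, coeff_zero]
  obtain ⟨γ, h, h0⟩ := exists_mem_ball_slice_ne_zero α hf
  rw [initForm_eq_slice h h0, coeff_slice, hu, HahnSeries.coeff_zero]

theorem totalDegree_initForm_le (α : ℝ) (f : MvPolynomial (Fin n) RevHahn) :
    (initForm α f).totalDegree ≤ f.totalDegree := by
  refine Finset.sup_mono fun u hu => ?_
  rw [mem_support_iff] at hu ⊢
  exact fun h => hu (coeff_initForm_eq_zero α h)

theorem initForm_X_mul (α : ℝ) (i : Fin n) (f : MvPolynomial (Fin n) RevHahn) :
    initForm α (X i * f) = X i * initForm α f := by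
  by_cases hf : f = 0
  · rw [hf, mul_zero, initForm_zero, mul_zero]
  obtain ⟨γ, h, h0⟩ := exists_mem_ball_slice_ne_zero α hf
  have h1 := slice_mul (X_mem_ball α i) h
  rw [slice_X] at h1
  rw [initForm_eq_slice h h0, ← h1]
  exact initForm_eq_slice (mul_mem_ball (X_mem_ball α i) h)
    (h1 ▸ mul_ne_zero (X_ne_zero i) h0)

/-- The space of initial forms of the elements of a subspace, together with zero. -/
def initSpace (α : ℝ) (V : Submodule RevHahn (MvPolynomial (Fin n) RevHahn)) :
    Submodule ℂ (MvPolynomial (Fin n) ℂ) where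
  carrier := {F | ∃ f ∈ V, f ∈ ball α 0 ∧ slice α 0 f = F}
  add_mem' := by
    rintro _ _ ⟨f, hfV, hf, rfl⟩ ⟨g, hgV, hg, rfl⟩
    exact ⟨f + g, add_mem hfV hgV, add_mem hf hg, map_add _ _ _⟩
  zero_mem' := ⟨0, zero_mem _, zero_mem _, map_zero _⟩
  smul_mem' := by
    rintro r _ ⟨f, hfV, hf, rfl⟩
    have h := C_mem_ball (n := n) α (C_mem_valLE r)
    refine ⟨C (HahnSeries.C r) * f, ?_, ?_, ?_⟩
    · rw [← smul_eq_C_mul]; exact V.smul_mem _ hfV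
    · simpa using mul_mem_ball h hf
    · have := slice_mul h hf
      rw [add_zero, slice_C] at this
      rw [this, smul_eq_C_mul]
      congr 2
      exact HahnSeries.coeff_single_same _ _

theorem mem_initSpace {α : ℝ} {V : Submodule RevHahn (MvPolynomial (Fin n) RevHahn)}
    {F : MvPolynomial (Fin n) ℂ} :
    F ∈ initSpace α V ↔ ∃ f ∈ V, f ∈ ball α 0 ∧ slice α 0 f = F := Iff.rfl

/-- Multiplication by `t^(-γ)` normalizes the weight to `0`. -/
theorem slice_mem_initSpace {α γ : ℝ} {V : Submodule RevHahn (MvPolynomial (Fin n) RevHahn)}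
    {f : MvPolynomial (Fin n) RevHahn} (hfV : f ∈ V) (hf : f ∈ ball α γ) :
    slice α γ f ∈ initSpace α V := by
  have h := C_mem_ball (n := n) α (tpow_mem_valLE (-γ))
  refine ⟨C (tpow (-γ)) * f, ?_, ?_, ?_⟩
  · rw [← smul_eq_C_mul]; exact V.smul_mem _ hfV
  · simpa using mul_mem_ball h hf
  · have := slice_mul h hf
    rwa [neg_add_cancel, slice_C, coeff_tpow, if_pos rfl, C_1, one_mul] at this

theorem initForm_mem_initSpace (α : ℝ) {V : Submodule RevHahn (MvPolynomial (Fin n) RevHahn)}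
    {f : MvPolynomial (Fin n) RevHahn} (hfV : f ∈ V) : initForm α f ∈ initSpace α V := by
  by_cases hf : f = 0
  · rw [hf, initForm_zero]; exact zero_mem _
  obtain ⟨γ, h, h0⟩ := exists_mem_ball_slice_ne_zero α hf
  rw [initForm_eq_slice h h0]
  exact slice_mem_initSpace hfV h

theorem exists_initForm_eq {α : ℝ} {V : Submodule RevHahn (MvPolynomial (Fin n) RevHahn)}
    {F : MvPolynomial (Fin n) ℂ} (hF : F ∈ initSpace α V) : ∃ f ∈ V, initForm α f = F := by
  obtain ⟨f, hfV, hf, rfl⟩ := hF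
  by_cases h0 : slice α 0 f = 0
  · exact ⟨0, zero_mem _, by rw [initForm_zero, h0]⟩
  · exact ⟨f, hfV, initForm_eq_slice hf h0⟩

theorem initSpace_mono (α : ℝ) {V W : Submodule RevHahn (MvPolynomial (Fin n) RevHahn)}
    (h : V ≤ W) : initSpace α V ≤ initSpace α W := by
  rintro _ ⟨f, hfV, hf, rfl⟩
  exact ⟨f, h hfV, hf, rfl⟩

theorem X_mul_mem_initSpace {α : ℝ} {V W : Submodule RevHahn (MvPolynomial (Fin n) RevHahn)}
    {i : Fin n} (h : ∀ f ∈ V, X i * f ∈ W) {F : MvPolynomial (Fin n) ℂ}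
    (hF : F ∈ initSpace α V) : X i * F ∈ initSpace α W := by
  obtain ⟨f, hfV, rfl⟩ := exists_initForm_eq hF
  rw [← initForm_X_mul]
  exact initForm_mem_initSpace α (h f hfV)

/-- The initial ideal consists of initial forms. -/
theorem mem_initIdeal_iff {α : ℝ} {I : Ideal (MvPolynomial (Fin n) RevHahn)}
    {F : MvPolynomial (Fin n) ℂ} : F ∈ initIdeal α I ↔ ∃ f ∈ I, initForm α f = F := by
  refine ⟨fun h => ?_, fun h => Ideal.subset_span h⟩
  -- The initial forms of elements of `I` already form a `ℂ`-space stable under multiplication by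
  -- variables, so generating an ideal adds nothing.
  suffices hS : F ∈ initSpace α (I.restrictScalars RevHahn) from exists_initForm_eq hS
  have hmul : ∀ p F : MvPolynomial (Fin n) ℂ, F ∈ initSpace α (I.restrictScalars RevHahn) →
      p * F ∈ initSpace α (I.restrictScalars RevHahn) := fun p => by
    induction p using MvPolynomial.induction_on with
    | C r => exact fun F hF => by rw [← smul_eq_C_mul]; exact Submodule.smul_mem _ _ hF
    | add p q hp hq => exact fun F hF => by rw [add_mul]; exact add_mem (hp F hF) (hq F hF)
    | mul_X p i hp =>
      exact fun F hF => by
        rw [mul_assoc]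
        exact hp _ (X_mul_mem_initSpace (fun f hf => I.mul_mem_left (X i) hf) hF)
  induction h using Submodule.span_induction with
  | mem F hF =>
    obtain ⟨f, hf, rfl⟩ := hF
    exact initForm_mem_initSpace α hf
  | zero => exact zero_mem _
  | add F G _ _ hF hG => exact add_mem hF hG
  | smul p F _ hF => exact hmul p F hF

theorem slice_mem_initIdeal {α γ : ℝ} {I : Ideal (MvPolynomial (Fin n) RevHahn)}
    {f : MvPolynomial (Fin n) RevHahn} (hfI : f ∈ I) (hf : f ∈ ball α γ) :
    slice α γ f ∈ initIdeal α I :=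
  mem_initIdeal_iff.2 (exists_initForm_eq
    (slice_mem_initSpace (V := I.restrictScalars RevHahn) hfI hf))

theorem pow_mem_valLE {c : RevHahn} {γ : ℝ} (hc : c ∈ valLE γ) (k : ℕ) :
    c ^ k ∈ valLE (γ * k) ∧ (c ^ k).coeff (toDual (γ * k)) = c.coeff (toDual γ) ^ k := by
  induction k with
  | zero => simpa [HahnSeries.coeff_one] using one_mem_valLE
  | succ k ih =>
    have h1 := mul_mem_valLE ih.1 hc
    have h2 := coeff_mul_of_mem_valLE ih.1 hc
    rw [ih.2] at h2
    have h3 : γ * (k + 1 : ℕ) = γ * k + γ := by push_cast; ring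
    rw [h3, pow_succ, pow_succ]
    exact ⟨h1, h2⟩

theorem prod_mem_valLE {ι : Type*} (s : Finset ι) {c : ι → RevHahn} {γ : ι → ℝ}
    (hc : ∀ i ∈ s, c i ∈ valLE (γ i)) :
    ∏ i ∈ s, c i ∈ valLE (∑ i ∈ s, γ i) ∧ (∏ i ∈ s, c i).coeff (toDual (∑ i ∈ s, γ i)) =
      ∏ i ∈ s, (c i).coeff (toDual (γ i)) := by
  classical
  induction s using Finset.induction_on with
  | empty => simpa [HahnSeries.coeff_one] using one_mem_valLE
  | insert a s ha ih =>
    obtain ⟨h1, h2⟩ := ih fun i hi => hc i (Finset.mem_insert_of_mem hi)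
    have h3 := hc a (Finset.mem_insert_self a s)
    rw [Finset.prod_insert ha, Finset.prod_insert ha, Finset.sum_insert ha, ← h2]
    exact ⟨mul_mem_valLE h3 h1, coeff_mul_of_mem_valLE h3 h1⟩

theorem coeff_eval {α γ : ℝ} {f : MvPolynomial (Fin n) RevHahn} (hf : f ∈ ball α γ)
    {z : Fin n → RevHahn} (hz : ∀ i, z i ∈ valLE α) :
    (eval z f).coeff (toDual γ) = eval (fun i => (z i).coeff (toDual α)) (slice α γ f) := by
  rw [eval_eq', slice_eq_sum, map_sum, HahnSeries.coeff_sum]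
  refine Finset.sum_congr rfl fun u _ => ?_
  obtain ⟨h1, h2⟩ := prod_mem_valLE Finset.univ fun i _ => (pow_mem_valLE (hz i) (u i)).1
  have h3 : ∑ i, α * (u i : ℝ) = α * (u.degree : ℝ) := by
    rw [Finsupp.degree_eq_sum, ← Finset.mul_sum]; push_cast; rfl
  rw [h3] at h1 h2
  have h4 := coeff_mul_of_mem_valLE (hf u) h1
  rw [sub_add_cancel] at h4
  rw [h4, h2, eval_monomial, Finsupp.prod_fintype _ _ (fun i => pow_zero _)]
  simp only [(pow_mem_valLE (hz _) _).2]

end AffineTrop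
end

/-! ### Eventual initial forms along a filter. -/

noncomputable section

namespace AffineTrop

open OrderDual MvPolynomial Filter Module

variable {n : ℕ}

/-- A filter along which every nonconstant affine function has eventually a constant sign. -/
def DecidesAffine (𝓕 : Filter ℝ) : Prop :=
  ∀ a b : ℝ, b ≠ 0 → (∀ᶠ α in 𝓕, a + b * α < 0) ∨ ∀ᶠ α in 𝓕, 0 < a + b * α

theorem DecidesAffine.nonpos_or_nonneg {𝓕 : Filter ℝ} (h𝓕 : DecidesAffine 𝓕) (a b : ℝ) :
    (∀ᶠ α in 𝓕, a + b * α ≤ 0) ∨ ∀ᶠ α in 𝓕, 0 ≤ a + b * α := by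
  by_cases hb : b = 0
  · rcases le_total a 0 with h | h
    · exact Or.inl (Eventually.of_forall fun α => by simpa [hb])
    · exact Or.inr (Eventually.of_forall fun α => by simpa [hb])
  · exact (h𝓕 a b hb).imp (fun h => h.mono fun _ => le_of_lt) fun h => h.mono fun _ => le_of_lt

theorem DecidesAffine.exists_max {𝓕 : Filter ℝ} (h𝓕 : DecidesAffine 𝓕) {ι : Type*} {s : Finset ι}
    (hs : s.Nonempty) (a b : ι → ℝ) :
    ∃ u ∈ s, ∀ v ∈ s, ∀ᶠ α in 𝓕, a v + b v * α ≤ a u + b u * α := by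
  classical
  induction hs using Finset.Nonempty.cons_induction with
  | singleton i => exact ⟨i, by simp, by simp⟩
  | cons i s hi hs ih =>
    obtain ⟨u, hu, hmax⟩ := ih
    rcases h𝓕.nonpos_or_nonneg (a i - a u) (b i - b u) with h | h
    · refine ⟨u, Finset.mem_cons_of_mem hu, fun v hv => ?_⟩
      rcases Finset.mem_cons.1 hv with rfl | hv
      · exact h.mono fun α hα => by linarith
      · exact hmax v hv
    · refine ⟨i, Finset.mem_cons_self _ _, fun v hv => ?_⟩
      rcases Finset.mem_cons.1 hv with rfl | hv
      · exact Eventually.of_forall fun _ => le_rfl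
      · filter_upwards [h, hmax v hv] with α h1 h2
        linarith

/-- The part of `f` made of the coefficients of `t^δ`, with `δ` the largest exponent in the
coefficient of `x^u`, of the terms of the same degree as `x^u`. -/
def leadComp (f : MvPolynomial (Fin n) RevHahn) (u : Fin n →₀ ℕ) : MvPolynomial (Fin n) ℂ :=
  homogeneousComponent u.degree (slice 0 (top (f.coeff u)) f)

theorem coeff_leadComp (f : MvPolynomial (Fin n) RevHahn) (u v : Fin n →₀ ℕ) :
    coeff v (leadComp f u) = if v.degree = u.degree then
      (f.coeff v).coeff (toDual (top (f.coeff u))) else 0 := by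
  rw [leadComp, coeff_homogeneousComponent, coeff_slice, zero_mul, sub_zero]

theorem isHomogeneous_leadComp (f : MvPolynomial (Fin n) RevHahn) (u : Fin n →₀ ℕ) :
    (leadComp f u).IsHomogeneous u.degree := homogeneousComponent_isHomogeneous _ _

theorem coeff_leadComp_self_ne_zero {f : MvPolynomial (Fin n) RevHahn} {u : Fin n →₀ ℕ}
    (hu : f.coeff u ≠ 0) : coeff u (leadComp f u) ≠ 0 := by
  rw [coeff_leadComp, if_pos rfl]
  exact coeff_top_ne_zero hu

theorem leadComp_eq_homogeneousComponent_slice (α : ℝ) (f : MvPolynomial (Fin n) RevHahn)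
    (u : Fin n →₀ ℕ) : leadComp f u =
      homogeneousComponent u.degree (slice α (top (f.coeff u) + α * (u.degree : ℝ)) f) := by
  ext v
  rw [coeff_leadComp, coeff_homogeneousComponent, coeff_slice]
  split_ifs with h
  · rw [h, add_sub_cancel_right]
  · rfl

theorem initForm_eq_leadComp {α : ℝ} {f : MvPolynomial (Fin n) RevHahn} {u : Fin n →₀ ℕ}
    (hu : f.coeff u ≠ 0)
    (hle : ∀ v ∈ f.support, top (f.coeff v) + (v.degree : ℝ) * α ≤
      top (f.coeff u) + (u.degree : ℝ) * α)
    (hlt : ∀ v ∈ f.support, v.degree ≠ u.degree → top (f.coeff v) + (v.degree : ℝ) * α <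
      top (f.coeff u) + (u.degree : ℝ) * α) : initForm α f = leadComp f u := by
  have hball : f ∈ ball α (top (f.coeff u) + α * (u.degree : ℝ)) := fun v => by
    by_cases hv : f.coeff v = 0
    · rw [hv]; exact zero_mem _
    · rw [mem_valLE_iff_top_le hv]
      linarith [hle v (mem_support_iff.2 hv)]
  have hslice : slice α (top (f.coeff u) + α * (u.degree : ℝ)) f = leadComp f u := by
    ext v
    rw [coeff_leadComp, coeff_slice]
    split_ifs with h
    · rw [h, add_sub_cancel_right]
    · by_cases hv : f.coeff v = 0
      · rw [hv, HahnSeries.coeff_zero]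
      · exact mem_valLE_top _ _ (by linarith [hlt v (mem_support_iff.2 hv) h])
  rw [← hslice]
  refine initForm_eq_slice hball fun h0 => coeff_leadComp_self_ne_zero hu ?_
  rw [← hslice, h0, coeff_zero]

/-- The values of the terms are affine in `α` with slope the degree. Along the filter one of them
eventually dominates, strictly over every term of another degree, so only terms of one degree
survive. -/
theorem DecidesAffine.exists_initForm_eq {𝓕 : Filter ℝ} (h𝓕 : DecidesAffine 𝓕)
    {f : MvPolynomial (Fin n) RevHahn} (hf : f ≠ 0) : ∃ u, f.coeff u ≠ 0 ∧
      (∀ v ∈ f.support, ∀ᶠ α in 𝓕, top (f.coeff v) + (v.degree : ℝ) * α ≤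
        top (f.coeff u) + (u.degree : ℝ) * α) ∧
      ∀ᶠ α in 𝓕, initForm α f = leadComp f u := by
  obtain ⟨u, hu, hmax⟩ := h𝓕.exists_max (support_nonempty.2 hf) (fun v => top (f.coeff v))
    (fun v => (v.degree : ℝ))
  refine ⟨u, mem_support_iff.1 hu, hmax, ?_⟩
  have h1 := (eventually_all_finset f.support).2 hmax
  have h2 : ∀ᶠ α in 𝓕, ∀ v ∈ f.support, v.degree ≠ u.degree →
      top (f.coeff v) + (v.degree : ℝ) * α < top (f.coeff u) + (u.degree : ℝ) * α := by
    refine (eventually_all_finset f.support).2 fun v hv => ?_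
    by_cases h : v.degree = u.degree
    · exact Eventually.of_forall fun α h' => absurd h h'
    · have hne : (v.degree : ℝ) - u.degree ≠ 0 := sub_ne_zero.2 (by exact_mod_cast h)
      rcases h𝓕 (top (f.coeff v) - top (f.coeff u)) _ hne with h3 | h3
      · exact h3.mono fun α hα _ => by linarith
      · filter_upwards [h3, hmax v hv] with α h4 h5
        linarith
  filter_upwards [h1, h2] with α h3 h4
  exact initForm_eq_leadComp (mem_support_iff.1 hu) h3 h4

/-- The span of the eventual initial forms of the elements of `V`. -/
def leadForms (𝓕 : Filter ℝ) (V : Submodule RevHahn (MvPolynomial (Fin n) RevHahn)) :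
    Submodule ℂ (MvPolynomial (Fin n) ℂ) :=
  Submodule.span ℂ {G | ∃ f ∈ V, ∀ᶠ α in 𝓕, initForm α f = G}

theorem leadForms_mono (𝓕 : Filter ℝ) {V W : Submodule RevHahn (MvPolynomial (Fin n) RevHahn)}
    (h : V ≤ W) : leadForms 𝓕 V ≤ leadForms 𝓕 W :=
  Submodule.span_mono fun _ ⟨f, hf, hG⟩ => ⟨f, h hf, hG⟩

theorem X_mul_mem_leadForms {𝓕 : Filter ℝ}
    {V W : Submodule RevHahn (MvPolynomial (Fin n) RevHahn)} {i : Fin n}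
    (h : ∀ f ∈ V, X i * f ∈ W) {F : MvPolynomial (Fin n) ℂ} (hF : F ∈ leadForms 𝓕 V) :
    X i * F ∈ leadForms 𝓕 W := by
  induction hF using Submodule.span_induction with
  | mem F hF =>
    obtain ⟨f, hf, hF⟩ := hF
    exact Submodule.subset_span ⟨X i * f, h f hf, hF.mono fun α hα => by rw [initForm_X_mul, hα]⟩
  | zero => rw [mul_zero]; exact zero_mem _
  | add F G _ _ hF hG => rw [mul_add]; exact add_mem hF hG
  | smul r F _ hF => rw [mul_smul_comm]; exact Submodule.smul_mem _ _ hF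

theorem eventually_mem_initSpace {𝓕 : Filter ℝ}
    {V : Submodule RevHahn (MvPolynomial (Fin n) RevHahn)} {F : MvPolynomial (Fin n) ℂ}
    (hF : F ∈ leadForms 𝓕 V) : ∀ᶠ α in 𝓕, F ∈ initSpace α V := by
  induction hF using Submodule.span_induction with
  | mem F hF =>
    obtain ⟨f, hf, hF⟩ := hF
    exact hF.mono fun α hα => hα ▸ initForm_mem_initSpace α hf
  | zero => exact Eventually.of_forall fun α => zero_mem _
  | add F G _ _ hF hG => exact (hF.and hG).mono fun α hα => add_mem hα.1 hα.2
  | smul r F _ hF => exact hF.mono fun α hα => Submodule.smul_mem _ _ hα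

theorem leadForms_le {𝓕 : Filter ℝ} [𝓕.NeBot]
    {V : Submodule RevHahn (MvPolynomial (Fin n) RevHahn)}
    {W : Submodule ℂ (MvPolynomial (Fin n) ℂ)} (h : ∀ α, ∀ f ∈ V, initForm α f ∈ W) :
    leadForms 𝓕 V ≤ W :=
  Submodule.span_le.2 fun _ ⟨f, hf, hG⟩ => by
    obtain ⟨α, rfl⟩ := hG.exists
    exact h α f hf

theorem initSpace_le_restrictTotalDegree {α : ℝ} {d : ℕ}
    {V : Submodule RevHahn (MvPolynomial (Fin n) RevHahn)}
    (hV : V ≤ restrictTotalDegree (Fin n) RevHahn d) :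
    initSpace α V ≤ restrictTotalDegree (Fin n) ℂ d := fun F hF => by
  obtain ⟨f, hf, rfl⟩ := exists_initForm_eq hF
  exact (mem_restrictTotalDegree _ _ _).2
    ((totalDegree_initForm_le α f).trans ((mem_restrictTotalDegree _ _ _).1 (hV hf)))

theorem leadForms_le_restrictTotalDegree {𝓕 : Filter ℝ} [𝓕.NeBot] {d : ℕ}
    {V : Submodule RevHahn (MvPolynomial (Fin n) RevHahn)}
    (hV : V ≤ restrictTotalDegree (Fin n) RevHahn d) :
    leadForms 𝓕 V ≤ restrictTotalDegree (Fin n) ℂ d :=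
  leadForms_le fun _ _ hf => initSpace_le_restrictTotalDegree hV (initForm_mem_initSpace _ hf)

theorem finiteDimensional_of_le_restrictTotalDegree {k : Type*} [Field k] {d : ℕ}
    {V : Submodule k (MvPolynomial (Fin n) k)} (hV : V ≤ restrictTotalDegree (Fin n) k d) :
    FiniteDimensional k V :=
  Submodule.finiteDimensional_of_le hV

theorem finrank_inf_ker_add_one {k E : Type*} [Field k] [AddCommGroup E] [Module k E]
    (W : Submodule k E) [FiniteDimensional k W] (l : E →ₗ[k] k) {w : E} (hw : w ∈ W)
    (hl : l w ≠ 0) : finrank k (W ⊓ LinearMap.ker l : Submodule k E) + 1 = finrank k W := by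
  have h1 := LinearMap.finrank_range_add_finrank_ker (l.domRestrict W)
  have h2 : LinearMap.range (l.domRestrict W) = ⊤ :=
    LinearMap.range_eq_top.2 (LinearMap.surjective (fun h => hl (by
      have := LinearMap.congr_fun h ⟨w, hw⟩
      simpa using this)))
  have h3 : finrank k (LinearMap.ker (l.domRestrict W)) =
      finrank k (W ⊓ LinearMap.ker l : Submodule k E) := by
    rw [LinearMap.ker_domRestrict, ← Submodule.map_comap_subtype]
    exact (Submodule.finrank_map_subtype_eq W _).symm
  rw [h2, finrank_top, finrank_self, h3] at h1
  omega

/-- Pick `f` whose eventual initial form contains `x^u`. Imposing that the coefficient of `x^u`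
vanish lowers both dimensions by one, and the eventual forms of the smaller space satisfy the
condition too; induct. -/
theorem finrank_le_finrank_leadForms {𝓕 : Filter ℝ} [𝓕.NeBot] (h𝓕 : DecidesAffine 𝓕) {d : ℕ}
    {V : Submodule RevHahn (MvPolynomial (Fin n) RevHahn)}
    (hV : V ≤ restrictTotalDegree (Fin n) RevHahn d) :
    finrank RevHahn V ≤ finrank ℂ (leadForms 𝓕 V) := by
  induction h : finrank RevHahn V generalizing V with
  | zero => exact Nat.zero_le _
  | succ k ih =>
    have hV0 : V ≠ ⊥ := by
      rintro rfl
      rw [finrank_bot] at h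
      omega
    obtain ⟨f, hfV, hf0⟩ := V.ne_bot_iff.1 hV0
    obtain ⟨u, hu, -, hev⟩ := h𝓕.exists_initForm_eq hf0
    have := finiteDimensional_of_le_restrictTotalDegree hV
    have := finiteDimensional_of_le_restrictTotalDegree
      (leadForms_le_restrictTotalDegree (𝓕 := 𝓕) hV)
    have h1 := finrank_inf_ker_add_one (E := MvPolynomial (Fin n) RevHahn) V
      (lcoeff RevHahn u) hfV hu
    have h2 := ih (inf_le_left.trans hV) (by omega :
      finrank RevHahn (V ⊓ LinearMap.ker (lcoeff RevHahn u) : Submodule _ _) = k)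
    have h3 := finrank_inf_ker_add_one (E := MvPolynomial (Fin n) ℂ) (leadForms 𝓕 V)
      (lcoeff ℂ u)
      (Submodule.subset_span ⟨f, hfV, hev⟩)
      (coeff_leadComp_self_ne_zero hu)
    have h4 : leadForms 𝓕 (V ⊓ LinearMap.ker (lcoeff RevHahn u)) ≤
        leadForms 𝓕 V ⊓ LinearMap.ker (lcoeff ℂ u) :=
      le_inf (leadForms_mono 𝓕 inf_le_left)
        (leadForms_le fun α f hf => coeff_initForm_eq_zero α hf.2)
    have := Submodule.finiteDimensional_of_le
      (inf_le_left : leadForms 𝓕 V ⊓ LinearMap.ker (lcoeff ℂ u) ≤ _)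
    have h5 := Submodule.finrank_mono h4
    omega

/-- Lifts of a basis of initial forms remain independent over `RevHahn`. -/
theorem finrank_initSpace_le {α : ℝ} {d : ℕ}
    {V : Submodule RevHahn (MvPolynomial (Fin n) RevHahn)}
    (hV : V ≤ restrictTotalDegree (Fin n) RevHahn d) :
    finrank ℂ (initSpace α V) ≤ finrank RevHahn V := by
  have := finiteDimensional_of_le_restrictTotalDegree hV
  have := finiteDimensional_of_le_restrictTotalDegree
    (initSpace_le_restrictTotalDegree (α := α) hV)
  let b := finBasis ℂ (initSpace α V)
  have hb : ∀ i, ∃ f ∈ V, f ∈ ball α 0 ∧ slice α 0 f = (b i : MvPolynomial (Fin n) ℂ) :=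
    fun i => mem_initSpace.1 (b i).2
  choose f hfV hf hslice using hb
  have hb' : LinearIndependent ℂ fun i => (b i : MvPolynomial (Fin n) ℂ) :=
    b.linearIndependent.map' (initSpace α V).subtype (Submodule.ker_subtype _)
  have hli : LinearIndependent RevHahn f := by
    refine linearIndependent_of_reduction (M := MvPolynomial (Fin n) RevHahn)
      (Q := MvPolynomial (Fin n) ℂ) hb' fun s c hc hsum => ?_
    rw [← map_zero (slice α 0), ← hsum, map_sum]
    refine Finset.sum_congr rfl fun i hi => ?_
    have h2 := slice_mul (C_mem_ball α (hc i hi)) (hf i)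
    rw [add_zero, slice_C, hslice i, ← smul_eq_C_mul, ← smul_eq_C_mul] at h2
    exact h2.symm
  have hliV : LinearIndependent RevHahn fun i => (⟨f i, hfV i⟩ : V) :=
    LinearIndependent.of_comp V.subtype hli
  simpa using hliV.fintype_card_le_finrank

/-! ### Uniformity in the degree by homogenization. -/

/-- The map sending the homogenizing variable to `T` and `x_i` to `x_i T`. -/
def reesMap : MvPolynomial (Option (Fin n)) ℂ →ₐ[ℂ] Polynomial (MvPolynomial (Fin n) ℂ) :=
  aeval fun o => o.elim Polynomial.X fun i => Polynomial.C (X i) * Polynomial.X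

/-- The homogeneous ideal of a compatible family of subspaces. -/
def reesIdeal (S : ℕ → Submodule ℂ (MvPolynomial (Fin n) ℂ)) (hS : ∀ d, S d ≤ S (d + 1))
    (hX : ∀ d i, ∀ F ∈ S d, X i * F ∈ S (d + 1)) : Ideal (MvPolynomial (Option (Fin n)) ℂ) where
  carrier := {p | ∀ d, (reesMap p).coeff d ∈ S d}
  add_mem' hp hq d := by rw [map_add, Polynomial.coeff_add]; exact add_mem (hp d) (hq d)
  zero_mem' d := by rw [map_zero, Polynomial.coeff_zero]; exact zero_mem _
  smul_mem' := by
    intro c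
    induction c using MvPolynomial.induction_on with
    | C r =>
      intro p hp d
      rw [smul_eq_mul, ← smul_eq_C_mul, map_smul, Polynomial.coeff_smul]
      exact Submodule.smul_mem _ _ (hp d)
    | add c c' hc hc' =>
      intro p hp d
      rw [add_smul, map_add, Polynomial.coeff_add]
      exact add_mem (hc hp d) (hc' hp d)
    | mul_X c o hc =>
      intro p hp d
      rw [smul_eq_mul, mul_assoc]
      refine hc (x := X o * p) (fun e => ?_) d
      rw [map_mul, reesMap, aeval_X]
      cases o with
      | none =>
        cases e with
        | zero => simp [zero_mem]
        | succ e =>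
          rw [Option.elim_none, mul_comm, Polynomial.coeff_mul_X]
          exact hS e (hp e)
      | some i =>
        cases e with
        | zero => simp [zero_mem]
        | succ e =>
          rw [Option.elim_some, mul_assoc, Polynomial.coeff_C_mul, mul_comm Polynomial.X,
            Polynomial.coeff_mul_X]
          exact hX e i _ (hp e)

/-- The monomial `x^u T^d` with `|u| ≤ d` comes from `x^u` times the power `d - |u|` of the
homogenizing variable. -/
theorem exists_reesMap_eq {d : ℕ} {F : MvPolynomial (Fin n) ℂ} (hF : F.totalDegree ≤ d) :
    ∃ p, reesMap p = Polynomial.monomial d F := by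
  classical
  have hmon : ∀ u ∈ F.support, ∃ p : MvPolynomial (Option (Fin n)) ℂ,
      reesMap p = Polynomial.monomial d (monomial u (F.coeff u)) := fun u hu => by
    have hud : u.degree ≤ d := (le_totalDegree hu).trans hF
    refine ⟨C (F.coeff u) * X none ^ (d - u.degree) * ∏ i, X (some i) ^ u i, ?_⟩
    simp only [map_mul, map_prod, map_pow, reesMap, aeval_X, Option.elim_none, Option.elim_some,
      mul_pow, Finset.prod_mul_distrib, Finset.prod_pow_eq_pow_sum, ← Finsupp.degree_eq_sum]
    rw [aeval_C, monomial_eq, Finsupp.prod_fintype _ _ (fun i => pow_zero _),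
      ← Polynomial.C_mul_X_pow_eq_monomial]
    nth_rewrite 2 [← Nat.sub_add_cancel hud]
    rw [pow_add, map_mul, map_prod]
    simp only [map_pow]
    rw [IsScalarTower.algebraMap_apply ℂ (MvPolynomial (Fin n) ℂ)]
    change Polynomial.C (C _) * _ * _ = _
    ring
  choose! p hp using hmon
  refine ⟨∑ u ∈ F.support, p u, ?_⟩
  rw [map_sum, Finset.sum_congr rfl hp, ← map_sum, support_sum_monomial_coeff]

/-- The elements of degree at most `d` of an ideal. -/
def degLE (I : Ideal (MvPolynomial (Fin n) RevHahn)) (d : ℕ) :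
    Submodule RevHahn (MvPolynomial (Fin n) RevHahn) :=
  I.restrictScalars RevHahn ⊓ restrictTotalDegree (Fin n) RevHahn d

theorem mem_degLE {I : Ideal (MvPolynomial (Fin n) RevHahn)} {d : ℕ}
    {f : MvPolynomial (Fin n) RevHahn} : f ∈ degLE I d ↔ f ∈ I ∧ f.totalDegree ≤ d := by
  rw [degLE, Submodule.mem_inf, mem_restrictTotalDegree, Submodule.restrictScalars_mem]

theorem degLE_le_succ (I : Ideal (MvPolynomial (Fin n) RevHahn)) (d : ℕ) :
    degLE I d ≤ degLE I (d + 1) := fun f hf => by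
  rw [mem_degLE] at hf ⊢
  exact ⟨hf.1, hf.2.trans d.le_succ⟩

theorem X_mul_mem_degLE {I : Ideal (MvPolynomial (Fin n) RevHahn)} {d : ℕ} (i : Fin n)
    {f : MvPolynomial (Fin n) RevHahn} (hf : f ∈ degLE I d) : X i * f ∈ degLE I (d + 1) := by
  rw [mem_degLE] at hf ⊢
  refine ⟨I.mul_mem_left _ hf.1, (totalDegree_mul _ _).trans ?_⟩
  rw [totalDegree_X, add_comm]
  exact Nat.succ_le_succ hf.2

/-- The point is to have one eventual set of `α` for all `d`. Assembled into an ideal in `n + 1`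
variables, the inclusions need only be tested on finitely many generators, each with finitely many
components. -/
theorem eventually_leadForms_le {𝓕 : Filter ℝ} [𝓕.NeBot]
    (I : Ideal (MvPolynomial (Fin n) RevHahn)) :
    ∀ᶠ α in 𝓕, ∀ d, leadForms 𝓕 (degLE I d) ≤ initSpace α (degLE I d) := by
  let N := reesIdeal (fun d => leadForms 𝓕 (degLE I d))
    (fun d => leadForms_mono 𝓕 (degLE_le_succ I d))
    (fun d i F hF => X_mul_mem_leadForms (fun f hf => X_mul_mem_degLE i hf) hF)
  let S := fun α => reesIdeal (fun d => initSpace α (degLE I d))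
    (fun d => initSpace_mono α (degLE_le_succ I d))
    (fun d i F hF => X_mul_mem_initSpace (fun f hf => X_mul_mem_degLE i hf) hF)
  obtain ⟨s, hs⟩ : N.FG := IsNoetherian.noetherian N
  have h1 : ∀ᶠ α in 𝓕, ∀ p ∈ s, p ∈ S α := by
    refine (eventually_all_finset s).2 fun p hp => ?_
    have hpN : p ∈ N := hs ▸ Submodule.subset_span hp
    have h2 := (eventually_all_finset (Finset.range ((reesMap p).natDegree + 1))).2
      fun d _ => eventually_mem_initSpace (hpN d)
    refine h2.mono fun α hα d => ?_
    by_cases hd : d ∈ Finset.range ((reesMap p).natDegree + 1)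
    · exact hα d hd
    · rw [Polynomial.coeff_eq_zero_of_natDegree_lt (by rw [Finset.mem_range] at hd; omega)]
      exact zero_mem _
  filter_upwards [h1] with α hα d F hF
  have hle : N ≤ S α := hs ▸ Submodule.span_le.2 hα
  obtain ⟨p, hp⟩ := exists_reesMap_eq ((mem_restrictTotalDegree _ _ _).1
    (leadForms_le_restrictTotalDegree (𝓕 := 𝓕) inf_le_right hF))
  have hpN : p ∈ N := fun e => by
    rw [hp, Polynomial.coeff_monomial]
    split_ifs with h
    · exact h ▸ hF
    · exact zero_mem _
  have h3 := hle hpN d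
  rwa [hp, Polynomial.coeff_monomial_same] at h3

/-- Along a filter deciding affine functions the initial ideal is eventually constant. -/
theorem eventually_mem_initIdeal_iff {𝓕 : Filter ℝ} [𝓕.NeBot] (h𝓕 : DecidesAffine 𝓕)
    (I : Ideal (MvPolynomial (Fin n) RevHahn)) :
    ∀ᶠ α in 𝓕, ∀ F, F ∈ initIdeal α I ↔ F ∈ leadForms 𝓕 (I.restrictScalars RevHahn) := by
  filter_upwards [eventually_leadForms_le (𝓕 := 𝓕) I] with α hα F
  have heq : ∀ d, leadForms 𝓕 (degLE I d) = initSpace α (degLE I d) := fun d => by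
    have := finiteDimensional_of_le_restrictTotalDegree
      (initSpace_le_restrictTotalDegree (α := α) (V := degLE I d) inf_le_right)
    -- The dimension of `degLE I d` separates the two: initial forms at `α` span no more, eventual
    -- ones no less.
    exact Submodule.eq_of_le_of_finrank_le (hα d)
      ((finrank_initSpace_le inf_le_right).trans (finrank_le_finrank_leadForms h𝓕 inf_le_right))
  rw [mem_initIdeal_iff]
  constructor
  · rintro ⟨f, hf, rfl⟩
    refine leadForms_mono 𝓕 inf_le_left (heq f.totalDegree ▸ ?_ :
      initForm α f ∈ leadForms 𝓕 (degLE I f.totalDegree))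
    exact initForm_mem_initSpace α (mem_degLE.2 ⟨hf, le_rfl⟩)
  · intro hF
    refine exists_initForm_eq (V := I.restrictScalars RevHahn) ?_
    refine (Submodule.span_le (p := initSpace α (I.restrictScalars RevHahn))).2 ?_ hF
    rintro G ⟨f, hf, hG⟩
    refine initSpace_mono α (inf_le_left : degLE I f.totalDegree ≤ _) ?_
    change G ∈ initSpace α (degLE I f.totalDegree)
    rw [← heq]
    exact Submodule.subset_span ⟨f, mem_degLE.2 ⟨hf, le_rfl⟩, hG⟩

end AffineTrop
end

/-! ### Critical levels. -/

noncomputable section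

namespace AffineTrop

open OrderDual MvPolynomial Filter Topology

variable {n : ℕ}

theorem decidesAffine_of_sign {𝓕 : Filter ℝ} {x : ℝ} (hx : 𝓕 ≤ 𝓝 x)
    (h : (∀ᶠ α in 𝓕, x < α) ∨ ∀ᶠ α in 𝓕, α < x) : DecidesAffine 𝓕 := by
  intro a b hb
  have hcont : Tendsto (fun α => a + b * α) 𝓕 (𝓝 (a + b * x)) :=
    ((by fun_prop : Continuous fun α => a + b * α).tendsto x).mono_left hx
  rcases lt_trichotomy (a + b * x) 0 with h0 | h0 | h0
  · exact Or.inl (hcont.eventually_lt_const h0)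
  · have heq : ∀ α, a + b * α = b * (α - x) := fun α => by linear_combination h0
    simp only [heq]
    rcases h with h | h <;> rcases lt_or_gt_of_ne hb with hb | hb
    · exact Or.inl (h.mono fun α hα => mul_neg_of_neg_of_pos hb (sub_pos.2 hα))
    · exact Or.inr (h.mono fun α hα => mul_pos hb (sub_pos.2 hα))
    · exact Or.inr (h.mono fun α hα => mul_pos_of_neg_of_neg hb (sub_neg.2 hα))
    · exact Or.inl (h.mono fun α hα => mul_neg_of_pos_of_neg hb (sub_neg.2 hα))
  · exact Or.inr (hcont.eventually_const_lt h0)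

theorem decidesAffine_nhdsGT (x : ℝ) : DecidesAffine (𝓝[>] x) :=
  decidesAffine_of_sign nhdsWithin_le_nhds (Or.inl self_mem_nhdsWithin)

theorem decidesAffine_nhdsLT (x : ℝ) : DecidesAffine (𝓝[<] x) :=
  decidesAffine_of_sign nhdsWithin_le_nhds (Or.inr self_mem_nhdsWithin)

theorem decidesAffine_atTop : DecidesAffine atTop := by
  intro a b hb
  rcases lt_or_gt_of_ne hb with hb | hb
  · refine Or.inl ((eventually_gt_atTop (-a / b)).mono fun α hα => ?_)
    rw [div_lt_iff_of_neg hb] at hα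
    linarith
  · refine Or.inr ((eventually_gt_atTop (-a / b)).mono fun α hα => ?_)
    rw [div_lt_iff₀ hb] at hα
    linarith

theorem decidesAffine_atBot : DecidesAffine atBot := by
  intro a b hb
  rcases lt_or_gt_of_ne hb with hb | hb
  · refine Or.inr ((eventually_lt_atBot (-a / b)).mono fun α hα => ?_)
    rw [lt_div_iff_of_neg hb] at hα
    linarith
  · refine Or.inl ((eventually_lt_atBot (-a / b)).mono fun α hα => ?_)
    rw [lt_div_iff₀ hb] at hα
    linarith

attribute [local instance] MvPolynomial.gradedAlgebra in
theorem isHomogeneousIdeal_iff {J : Ideal (MvPolynomial (Fin n) ℂ)} :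
    IsHomogeneousIdeal J ↔ ∀ F ∈ J, ∀ d, homogeneousComponent d F ∈ J := by
  refine ⟨fun h F hF d => (mem_iff_homogeneousComponent_mem h F).1 hF d, fun h d F hF => ?_⟩
  have := decomposition.decompose'_apply F d
  exact (congrArg (· ∈ J) this).mpr (h F hF d)

theorem homogeneousComponent_eq_self_or_zero {F : MvPolynomial (Fin n) ℂ} {d : ℕ}
    (hF : F.IsHomogeneous d) (e : ℕ) :
    homogeneousComponent e F = F ∨ homogeneousComponent e F = 0 := by
  rw [homogeneousComponent_of_mem ((mem_homogeneousSubmodule _ _).2 hF)]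
  split_ifs
  · exact Or.inl rfl
  · exact Or.inr rfl

theorem homogeneousComponent_mem_leadForms {𝓕 : Filter ℝ} [𝓕.NeBot] (h𝓕 : DecidesAffine 𝓕)
    {V : Submodule RevHahn (MvPolynomial (Fin n) RevHahn)} {F : MvPolynomial (Fin n) ℂ}
    (hF : F ∈ leadForms 𝓕 V) (d : ℕ) : homogeneousComponent d F ∈ leadForms 𝓕 V := by
  induction hF using Submodule.span_induction with
  | mem F hF =>
    obtain ⟨f, hf, hev⟩ := hF
    by_cases hf0 : f = 0
    · obtain ⟨α, rfl⟩ := hev.exists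
      rw [hf0, initForm_zero, map_zero]
      exact zero_mem _
    · obtain ⟨u, -, -, hu⟩ := h𝓕.exists_initForm_eq hf0
      obtain ⟨α, h1, h2⟩ := (hev.and hu).exists
      rcases homogeneousComponent_eq_self_or_zero (h1.symm.trans h2 ▸ isHomogeneous_leadComp f u) d
        with h | h
      · rw [h]; exact Submodule.subset_span ⟨f, hf, hev⟩
      · rw [h]; exact zero_mem _
  | zero => rw [map_zero]; exact zero_mem _
  | add F G _ _ hF hG => rw [map_add]; exact add_mem hF hG
  | smul r F _ hF => rw [map_smul]; exact Submodule.smul_mem _ _ hF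

theorem eventually_isHomogeneousIdeal {𝓕 : Filter ℝ} [𝓕.NeBot] (h𝓕 : DecidesAffine 𝓕)
    (I : Ideal (MvPolynomial (Fin n) RevHahn)) :
    ∀ᶠ α in 𝓕, IsHomogeneousIdeal (initIdeal α I) := by
  filter_upwards [eventually_mem_initIdeal_iff h𝓕 I] with α hα
  refine isHomogeneousIdeal_iff.2 fun F hF d => ?_
  rw [hα] at hF ⊢
  exact homogeneousComponent_mem_leadForms h𝓕 hF d

/-- Near a level the initial form is a homogeneous component of the initial form at the level. -/
theorem exists_eventually_eq_homogeneousComponent {𝓕 : Filter ℝ} [𝓕.NeBot]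
    (h𝓕 : DecidesAffine 𝓕) {x : ℝ} (hx : 𝓕 ≤ 𝓝 x) (f : MvPolynomial (Fin n) RevHahn) :
    ∃ d, ∀ᶠ α in 𝓕, initForm α f = homogeneousComponent d (initForm x f) := by
  by_cases hf : f = 0
  · exact ⟨0, Eventually.of_forall fun α => by rw [hf, initForm_zero, initForm_zero, map_zero]⟩
  obtain ⟨u, hu, hmax, hev⟩ := h𝓕.exists_initForm_eq hf
  refine ⟨u.degree, ?_⟩
  have hball : f ∈ ball x (top (f.coeff u) + x * (u.degree : ℝ)) := fun v => by
    by_cases hv : f.coeff v = 0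
    · rw [hv]; exact zero_mem _
    · rw [mem_valLE_iff_top_le hv]
      have hcont : ∀ a b : ℝ, Tendsto (fun α => a + b * α) 𝓕 (𝓝 (a + b * x)) := fun a b =>
        ((by fun_prop : Continuous fun α => a + b * α).tendsto x).mono_left hx
      have := le_of_tendsto_of_tendsto (hcont _ _) (hcont _ _) (hmax v (mem_support_iff.2 hv))
      linarith
  -- The eventually dominant term is, by passing to the limit, still maximal at `x`, where terms of
  -- other degrees may tie with it.
  have h1 := leadComp_eq_homogeneousComponent_slice x f u
  have h2 : initForm x f = slice x (top (f.coeff u) + x * (u.degree : ℝ)) f := by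
    refine initForm_eq_slice hball fun h0 => coeff_leadComp_self_ne_zero hu ?_
    rw [h1, h0, map_zero, coeff_zero]
  rw [h2, ← h1]
  exact hev

/-- Near `x` initial forms are homogeneous components of those at `x`, so they stay in a homogeneous
`IN_x(I)`. Conversely a homogeneous initial form at `x` persists: the nearby form is one of its
components and is not zero. -/
theorem eventually_initIdeal_eq {𝓕 : Filter ℝ} [𝓕.NeBot] (h𝓕 : DecidesAffine 𝓕) {x : ℝ}
    (hx : 𝓕 ≤ 𝓝 x) {I : Ideal (MvPolynomial (Fin n) RevHahn)}
    (hI : IsHomogeneousIdeal (initIdeal x I)) : ∀ᶠ α in 𝓕, initIdeal α I = initIdeal x I := by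
  rw [isHomogeneousIdeal_iff] at hI
  filter_upwards [eventually_mem_initIdeal_iff h𝓕 I] with α hα
  ext F
  rw [hα]
  constructor
  · intro hF
    induction hF using Submodule.span_induction with
    | mem F hF =>
      obtain ⟨f, hf, hev⟩ := hF
      obtain ⟨d, hd⟩ := exists_eventually_eq_homogeneousComponent h𝓕 hx f
      obtain ⟨α, h1, h2⟩ := (hev.and hd).exists
      rw [← h1, h2]
      exact hI _ (Ideal.subset_span ⟨f, hf, rfl⟩) d
    | zero => exact zero_mem _
    | add F G _ _ hF hG => exact add_mem hF hG
    | smul r F _ hF => rw [smul_eq_C_mul]; exact Ideal.mul_mem_left _ _ hF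
  · intro hF
    rw [← sum_homogeneousComponent F]
    refine sum_mem fun d _ => ?_
    obtain ⟨f, hf, hfd⟩ := mem_initIdeal_iff.1 (hI F hF d)
    by_cases hf0 : f = 0
    · rw [← hfd, hf0, initForm_zero]; exact zero_mem _
    obtain ⟨e, he⟩ := exists_eventually_eq_homogeneousComponent h𝓕 hx f
    refine Submodule.subset_span ⟨f, hf, ?_⟩
    rcases homogeneousComponent_eq_self_or_zero (hfd ▸ homogeneousComponent_isHomogeneous d F :
      (initForm x f).IsHomogeneous d) e with h | h
    · rwa [h, hfd] at he
    · obtain ⟨α, hα⟩ := he.exists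
      exact absurd (hα.trans h) (initForm_ne_zero α hf0)

/-- The levels at which the initial ideal is not homogeneous. -/
def criticalLevels (I : Ideal (MvPolynomial (Fin n) RevHahn)) : Set ℝ :=
  {α | ¬ IsHomogeneousIdeal (initIdeal α I)}

/-- The filters at `±∞` bound the set; an accumulation point would contradict eventual homogeneity
on one of its two sides. -/
theorem finite_criticalLevels (I : Ideal (MvPolynomial (Fin n) RevHahn)) :
    (criticalLevels I).Finite := by
  by_contra hinf
  obtain ⟨b, hb⟩ := eventually_atTop.1 (eventually_isHomogeneousIdeal decidesAffine_atTop I)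
  obtain ⟨a, ha⟩ := eventually_atBot.1 (eventually_isHomogeneousIdeal decidesAffine_atBot I)
  have hsub : criticalLevels I ⊆ Set.Icc a b := fun α hα => by
    constructor <;> by_contra! h
    · exact hα (ha α h.le)
    · exact hα (hb α h.le)
  obtain ⟨x, -, hx⟩ := Set.Infinite.exists_accPt_of_subset_isCompact hinf isCompact_Icc hsub
  rw [accPt_iff_frequently_nhdsNE] at hx
  refine hx ?_
  rw [← nhdsLT_sup_nhdsGT, eventually_sup]
  exact ⟨(eventually_isHomogeneousIdeal (decidesAffine_nhdsLT x) I).mono fun _ h h' => h' h,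
    (eventually_isHomogeneousIdeal (decidesAffine_nhdsGT x) I).mono fun _ h h' => h' h⟩

/-- A locally constant map is constant on a connected set, the ideals carrying the discrete
topology. -/
theorem initIdeal_eq_of_ordConnected {I : Ideal (MvPolynomial (Fin n) RevHahn)} {s : Set ℝ}
    (hs : s.OrdConnected) (hI : ∀ α ∈ s, IsHomogeneousIdeal (initIdeal α I)) {α α' : ℝ}
    (hα : α ∈ s) (hα' : α' ∈ s) : initIdeal α I = initIdeal α' I := by
  let _ : TopologicalSpace (Ideal (MvPolynomial (Fin n) ℂ)) := ⊥
  have : DiscreteTopology (Ideal (MvPolynomial (Fin n) ℂ)) := ⟨rfl⟩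
  refine hs.isPreconnected.constant (f := fun α => initIdeal α I) (fun x hx => ?_) hα hα'
  have h : ∀ᶠ α in 𝓝 x, initIdeal α I = initIdeal x I := by
    rw [← nhdsNE_sup_pure, ← nhdsLT_sup_nhdsGT, eventually_sup, eventually_sup, eventually_pure]
    exact ⟨⟨eventually_initIdeal_eq (decidesAffine_nhdsLT x) nhdsWithin_le_nhds (hI x hx),
      eventually_initIdeal_eq (decidesAffine_nhdsGT x) nhdsWithin_le_nhds (hI x hx)⟩, rfl⟩
  exact (continuousAt_const.congr (h.mono fun _ h => h.symm)).continuousWithinAt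

theorem ordConnected_gap {r : ℕ} (β : Fin r → ℝ) (i : Fin (r + 1)) : (gap β i).OrdConnected :=
  ⟨fun _ hx _ hy _ hz j => ⟨fun h => ((hx j).1 h).trans_le hz.1,
    fun h => hz.2.trans_lt ((hy j).2 h)⟩⟩

theorem notMem_gap {r : ℕ} (β : Fin r → ℝ) (i : Fin (r + 1)) (j : Fin r) : β j ∉ gap β i :=
  fun h => by
    rcases lt_or_ge j.castSucc i with hij | hij
    · exact lt_irrefl _ ((h j).1 hij)
    · exact lt_irrefl _ ((h j).2 hij)

theorem exists_criticalLevels (I : Ideal (MvPolynomial (Fin n) RevHahn)) :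
    ∃ (r : ℕ) (β : Fin r → ℝ), StrictMono β ∧
      (∀ i : Fin (r + 1),
        (∀ α ∈ gap β i, IsHomogeneousIdeal (initIdeal α I)) ∧
        (∀ α ∈ gap β i, ∀ α' ∈ gap β i, initIdeal α I = initIdeal α' I)) ∧
      (∀ j : Fin r, ¬ IsHomogeneousIdeal (initIdeal (β j) I)) := by
  let s := (finite_criticalLevels I).toFinset
  have hs : ∀ α, α ∈ s ↔ ¬ IsHomogeneousIdeal (initIdeal α I) := fun α =>
    (finite_criticalLevels I).mem_toFinset
  let β := s.orderEmbOfFin rfl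
  have hgap : ∀ i, ∀ α ∈ gap β i, IsHomogeneousIdeal (initIdeal α I) := fun i α hα => by
    by_contra h
    have h1 : α ∈ Set.range β := by
      rw [Finset.range_orderEmbOfFin]
      exact (hs α).2 h
    obtain ⟨j, rfl⟩ := h1
    exact notMem_gap β i j hα
  exact ⟨s.card, β, β.strictMono, fun i => ⟨hgap i, fun α hα α' hα' =>
    initIdeal_eq_of_ordConnected (ordConnected_gap β i) (hgap i) hα hα'⟩,
    fun j => (hs _).1 (s.orderEmbOfFin_mem rfl j)⟩

end AffineTrop
end

/-! ### Leading parts and lifting of zeros. -/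

noncomputable section

namespace AffineTrop

open OrderDual MvPolynomial Filter Topology

variable {n : ℕ}

theorem leadingPart_eq {z : Fin n → RevHahn} {α : ℝ} (hz : ∀ i, z i ∈ valLE α)
    (h0 : (fun i => (z i).coeff (toDual α)) ≠ 0) :
    leadingPart z = (α, fun i => (z i).coeff (toDual α)) := by
  have hval : vecVal z = (α : WithBot ℝ) := by
    refine le_antisymm (Finset.sup_le fun i _ => mem_valLE_iff_val_le.1 (hz i)) ?_
    obtain ⟨i, hi⟩ := Function.ne_iff.1 h0
    have hi0 : z i ≠ 0 := HahnSeries.ne_zero_of_coeff_ne_zero hi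
    refine le_trans ?_ (Finset.le_sup (f := fun i => val (z i)) (Finset.mem_univ i))
    rw [val_of_ne_zero hi0, WithBot.coe_le_coe]
    by_contra! hlt
    exact hi (mem_valLE_top _ _ hlt)
  rw [leadingPart, hval, WithBot.unbotD_coe]

theorem exists_level {z : Fin n → RevHahn} (hz : z ≠ 0) :
    ∃ α, (∀ i, z i ∈ valLE α) ∧ (fun i => (z i).coeff (toDual α)) ≠ 0 := by
  classical
  obtain ⟨i, hi⟩ := Function.ne_iff.1 hz
  obtain ⟨j, hj, hmax⟩ := (Finset.univ.filter (z · ≠ 0)).exists_max_image (fun i => top (z i))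
    ⟨i, Finset.mem_filter.2 ⟨Finset.mem_univ i, hi⟩⟩
  refine ⟨top (z j), fun k => ?_, fun h => coeff_top_ne_zero (Finset.mem_filter.1 hj).2
    (congrFun h j)⟩
  by_cases hk : z k = 0
  · rw [hk]; exact zero_mem _
  · rw [mem_valLE_iff_top_le hk]
    exact hmax k (Finset.mem_filter.2 ⟨Finset.mem_univ k, hk⟩)

theorem coeff_mem_zeroLocus {I : Ideal (MvPolynomial (Fin n) RevHahn)} {z : Fin n → RevHahn}
    (hzI : z ∈ zeroLocus RevHahn I) {α : ℝ} (hz : ∀ i, z i ∈ valLE α) :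
    (fun i => (z i).coeff (toDual α)) ∈ zeroLocus ℂ (initIdeal α I) := by
  rw [mem_zeroLocus_iff] at hzI ⊢
  intro F hF
  obtain ⟨f, hf, rfl⟩ := mem_initIdeal_iff.1 hF
  by_cases hf0 : f = 0
  · rw [hf0, initForm_zero, map_zero]
  obtain ⟨γ, h, h0⟩ := exists_mem_ball_slice_ne_zero α hf0
  have h1 := hzI f hf
  rw [aeval_eq_eval] at h1
  rw [initForm_eq_slice h h0, aeval_eq_eval]
  exact (coeff_eval h hz).symm.trans (by rw [show eval z f = 0 from h1, HahnSeries.coeff_zero])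

/-- The polynomials `f` with `ν_α(f) ≤ 0`, as a ring. -/
def ballRing (α : ℝ) : Subring (MvPolynomial (Fin n) RevHahn) where
  __ := ball α 0
  mul_mem' hf hg := by simpa using mul_mem_ball hf hg
  one_mem' := by simpa using C_mem_ball α one_mem_valLE

theorem mem_ballRing {α : ℝ} {f : MvPolynomial (Fin n) RevHahn} :
    f ∈ ballRing α ↔ f ∈ ball α 0 := Iff.rfl

theorem aeval_mem_ball {α γ : ℝ} {l : Fin n → MvPolynomial (Fin n) RevHahn}
    (hl : ∀ i, l i ∈ ball α 0) {f : MvPolynomial (Fin n) RevHahn} (hf : f ∈ ball 0 γ) :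
    aeval l f ∈ ball α γ := by
  rw [aeval_def, eval₂_eq']
  refine sum_mem fun u _ => ?_
  have h1 : ∏ i, l i ^ u i ∈ ballRing α := prod_mem fun i _ =>
    pow_mem (mem_ballRing.2 (hl i)) _
  have h2 : f.coeff u ∈ valLE γ := by simpa using hf u
  simpa using mul_mem_ball (C_mem_ball α h2) h1

theorem exists_mem_ball (α : ℝ) (f : MvPolynomial (Fin n) RevHahn) : ∃ γ, f ∈ ball α γ := by
  by_cases hf : f = 0
  · exact ⟨0, hf ▸ zero_mem _⟩
  · exact (exists_mem_ball_slice_ne_zero α hf).imp fun _ h => h.1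

theorem C_tpow_mul_mem_ball {α γ : ℝ} {f : MvPolynomial (Fin n) RevHahn} (hf : f ∈ ball α γ) :
    C (tpow (-γ)) * f ∈ ball α 0 := by
  simpa using mul_mem_ball (C_mem_ball α (tpow_mem_valLE (-γ))) hf

/-- If no initial form at level `0` has a constant term, neither has any at levels slightly
below `0`. -/
theorem exists_neg_forall_coeff_zero_initForm {I : Ideal (MvPolynomial (Fin n) RevHahn)}
    (hI : ∀ f ∈ I, coeff 0 (initForm 0 f) = 0) :
    ∃ α < 0, ∀ f ∈ I, coeff 0 (initForm α f) = 0 := by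
  have hlead : ∀ F ∈ leadForms (𝓝[<] 0) (I.restrictScalars RevHahn), coeff 0 F = 0 :=
    fun F hF => by
      refine (Submodule.span_le (p := LinearMap.ker (lcoeff ℂ 0))).2 ?_ hF
      rintro F ⟨f, hf, hev⟩
      obtain ⟨d, hd⟩ := exists_eventually_eq_homogeneousComponent (decidesAffine_nhdsLT 0)
        nhdsWithin_le_nhds f
      obtain ⟨α, h1, h2⟩ := (hev.and hd).exists
      change coeff 0 F = 0
      -- A homogeneous component of a form at level `0` has as constant term either `0` or that of
      -- the form, which vanishes as well.
      rw [← h1, h2, coeff_homogeneousComponent, hI f hf, ite_self]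
  obtain ⟨α, h1, h2⟩ := ((eventually_mem_initIdeal_iff (decidesAffine_nhdsLT 0) I).and
    self_mem_nhdsWithin).exists
  exact ⟨α, h2, fun f hf => hlead _ ((h1 _).1 (Ideal.subset_span ⟨f, hf, rfl⟩))⟩

/-- The polynomials bounded by one on a polydisc, up to an ideal. -/
def residueBall (α : ℝ) (I : Ideal (MvPolynomial (Fin n) RevHahn)) :
    Subring (MvPolynomial (Fin n) RevHahn) where
  carrier := {a | ∃ b ∈ ballRing α, a - b ∈ I}
  mul_mem' := by
    rintro a a' ⟨b, hb, hab⟩ ⟨b', hb', hab'⟩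
    refine ⟨b * b', mul_mem hb hb', ?_⟩
    rw [show a * a' - b * b' = a * (a' - b') + b' * (a - b) by ring]
    exact add_mem (I.mul_mem_left _ hab') (I.mul_mem_left _ hab)
  one_mem' := ⟨1, one_mem _, by rw [sub_self]; exact zero_mem _⟩
  add_mem' := by
    rintro a a' ⟨b, hb, hab⟩ ⟨b', hb', hab'⟩
    exact ⟨b + b', add_mem hb hb', by
      rw [show a + a' - (b + b') = (a - b) + (a' - b') by ring]
      exact add_mem hab hab'⟩
  zero_mem' := ⟨0, zero_mem _, by rw [sub_self]; exact zero_mem _⟩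
  neg_mem' := by
    rintro a ⟨b, hb, hab⟩
    exact ⟨-b, neg_mem hb, by
      rw [show -a - -b = -1 * (a - b) by ring]
      exact I.mul_mem_left _ hab⟩

theorem mem_residueBall {α : ℝ} {I : Ideal (MvPolynomial (Fin n) RevHahn)}
    {a : MvPolynomial (Fin n) RevHahn} : a ∈ residueBall α I ↔ ∃ b ∈ ball α 0, a - b ∈ I :=
  Iff.rfl

/-- If `t - b ∈ I` with `b` bounded by one, its initial form would be the constant `1`. -/
theorem tpowIn_one_notMem_residueBall {α : ℝ} {I : Ideal (MvPolynomial (Fin n) RevHahn)}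
    (hI : ∀ f ∈ I, coeff 0 (initForm α f) = 0) :
    tpowIn (MvPolynomial (Fin n) RevHahn) 1 ∉ residueBall α I := fun h => by
  obtain ⟨b, hb, hbI⟩ := mem_residueBall.1 h
  change C (tpow 1) - b ∈ I at hbI
  have h1 : C (tpow 1) - b ∈ ball α 1 :=
    sub_mem (C_mem_ball α (tpow_mem_valLE 1)) (ball_mono α zero_le_one hb)
  have h2 : slice α 1 (C (tpow 1) - b) = 1 := by
    rw [map_sub, slice_C, slice_eq_zero_of_lt zero_lt_one hb, coeff_tpow, if_pos rfl, C_1,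
      sub_zero]
  have h3 := hI _ hbI
  rw [initForm_eq_slice h1 (h2 ▸ one_ne_zero), h2, coeff_zero_one] at h3
  exact one_ne_zero h3

theorem rank_mvPolynomial_le_aleph0 :
    Module.rank RevHahn (MvPolynomial (Fin n) RevHahn) ≤ Cardinal.aleph0 := by
  rw [MvPolynomial.rank_eq]
  exact Cardinal.mk_le_aleph0

/-- An ideal whose initial forms at level `0` have no constant term has a zero with all
coordinates of negative valuation. -/
theorem exists_mem_zeroLocus_valLT {I : Ideal (MvPolynomial (Fin n) RevHahn)}
    (hI : ∀ f ∈ I, coeff 0 (initForm 0 f) = 0) :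
    ∃ z ∈ zeroLocus RevHahn I, ∀ i, z i ∈ valLT 0 := by
  obtain ⟨α, hα, hIα⟩ := exists_neg_forall_coeff_zero_initForm hI
  have hball : ∀ a ∈ ball α 0, a ∈ residueBall α I := fun a ha =>
    mem_residueBall.2 ⟨a, ha, by rw [sub_self]; exact zero_mem _⟩
  have hideal : ∀ a ∈ I, a ∈ residueBall α I := fun a ha =>
    mem_residueBall.2 ⟨0, zero_mem _, by rwa [show a - 0 = a by ring]⟩
  obtain ⟨φ, hφ⟩ := exists_algHom_of_tpowIn_one_notMem rank_mvPolynomial_le_aleph0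
    (residueBall α I) (fun c hc => hball _ (C_mem_ball α hc))
    (tpowIn_one_notMem_residueBall hIα)
    (fun a => (exists_mem_ball α a).elim fun γ h => ⟨-γ, hball _ (C_tpow_mul_mem_ball h)⟩)
  have hφC : ∀ c a, φ (C c * a) = c * φ a := fun c a => by
    rw [← smul_eq_C_mul, map_smul, smul_eq_mul]
  refine ⟨fun i => φ (X i), ?_, fun i => ?_⟩
  · rw [mem_zeroLocus_iff]
    intro f hf
    have h1 : aeval (fun i => φ (X i)) f = φ f := (DFunLike.congr_fun (aeval_unique φ) f).symm
    rw [h1]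
    -- All multiples of `f` by powers of `t` lie in the ideal, hence in the ball, so `φ f` has
    -- arbitrarily small valuation.
    refine eq_zero_of_forall_mem_valLE fun γ => ?_
    have h2 := hφ _ (hideal _ (I.mul_mem_left (C (tpow (-γ))) hf))
    rwa [hφC, tpow_mul_mem_valLE_iff, zero_sub, neg_neg] at h2
  · have h2 := hφ _ (hball _ (C_tpow_mul_mem_ball (X_mem_ball α i)))
    rw [hφC, tpow_mul_mem_valLE_iff, zero_sub, neg_neg] at h2
    exact valLE_le_valLT hα h2

/-- Every zero of the initial ideal lifts. -/
theorem exists_mem_zeroLocus_coeff_eq {I : Ideal (MvPolynomial (Fin n) RevHahn)} {α : ℝ}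
    {B : Fin n → ℂ} (hB : B ∈ zeroLocus ℂ (initIdeal α I)) :
    ∃ z ∈ zeroLocus RevHahn I, (∀ i, z i ∈ valLE α) ∧
      (fun i => (z i).coeff (toDual α)) = B := by
  -- This change of variables carries the point `w = t^α B` to the origin and level `α` to level
  -- `0`.
  let ψ : MvPolynomial (Fin n) RevHahn →ₐ[RevHahn] MvPolynomial (Fin n) RevHahn :=
    aeval fun i => C (tpow (-α)) * X i - C (HahnSeries.C (B i))
  have hψball : ∀ {f : MvPolynomial (Fin n) RevHahn} {γ : ℝ}, f ∈ ball 0 γ → ψ f ∈ ball α γ :=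
    fun hf => aeval_mem_ball (fun i => sub_mem (C_tpow_mul_mem_ball (X_mem_ball α i))
      (C_mem_ball α (C_mem_valLE _))) hf
  let w : Fin n → RevHahn := fun i => HahnSeries.C (B i) * tpow α
  have hw : ∀ i, w i ∈ valLE α := fun i => C_mul_mem_valLE _ (tpow_mem_valLE α)
  have hwB : (fun i => (w i).coeff (toDual α)) = B := funext fun i => by
    rw [coeff_C_mul, coeff_tpow, if_pos rfl, mul_one]
  have hwψ : ∀ f, eval w (ψ f) = coeff 0 f := fun f => by
    have h1 : (aeval w).comp ψ = aeval (0 : Fin n → RevHahn) := by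
      refine algHom_ext fun i => ?_
      rw [AlgHom.comp_apply, aeval_X, aeval_X, map_sub, map_mul, aeval_X, aeval_C, aeval_C]
      change tpow (-α) * (HahnSeries.C (B i) * tpow α) - HahnSeries.C (B i) = 0
      linear_combination HahnSeries.C (B i) * tpow_mul_tpow_neg α
    have h2 := DFunLike.congr_fun h1 f
    rw [AlgHom.comp_apply, aeval_eq_eval] at h2
    rw [show eval w (ψ f) = _ from h2, aeval_zero]
    rfl
  have hI' : ∀ f ∈ I.comap ψ, coeff 0 (initForm 0 f) = 0 := fun f hf => by
    by_cases hf0 : f = 0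
    · rw [hf0, initForm_zero, coeff_zero]
    obtain ⟨γ, h, h0⟩ := exists_mem_ball_slice_ne_zero 0 hf0
    -- The constant term of the initial form is the `t^γ`-coefficient of `f(0) = (ψ f)(w)`, that is,
    -- the value at `B` of a slice of `ψ f`, which belongs to the initial ideal.
    rw [initForm_eq_slice h h0, coeff_slice, zero_mul, sub_zero, ← hwψ,
      coeff_eval (hψball h) hw, hwB]
    exact (mem_zeroLocus_iff.1 hB) _ (slice_mem_initIdeal hf (hψball h))
  obtain ⟨y, hyI, hy⟩ := exists_mem_zeroLocus_valLT hI'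
  -- Since `ψ` undoes `ψ'`, the latter maps `I` into `I.comap ψ`; a zero `y` of the comap thus gives
  -- the zero `t^α (y + B)` of `I`.
  let ψ' : MvPolynomial (Fin n) RevHahn →ₐ[RevHahn] MvPolynomial (Fin n) RevHahn :=
    aeval fun i => C (tpow α) * (X i + C (HahnSeries.C (B i)))
  have hψψ' : ψ.comp ψ' = AlgHom.id _ _ := by
    refine algHom_ext fun i => ?_
    rw [AlgHom.comp_apply, aeval_X, map_mul, map_add, aeval_X, AlgHom.id_apply]
    change ψ (algebraMap _ _ _) * (_ + ψ (algebraMap _ _ _)) = _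
    rw [AlgHom.commutes, AlgHom.commutes]
    change C (tpow α) * (C (tpow (-α)) * X i - C (HahnSeries.C (B i)) + C (HahnSeries.C (B i))) = _
    rw [sub_add_cancel, ← mul_assoc, ← C_mul, tpow_mul_tpow_neg, C_1, one_mul]
  refine ⟨fun i => tpow α * (y i + HahnSeries.C (B i)), ?_, fun i => ?_, funext fun i => ?_⟩
  · rw [mem_zeroLocus_iff] at hyI ⊢
    intro f hf
    have h1 : (aeval y).comp ψ' = aeval fun i => tpow α * (y i + HahnSeries.C (B i)) := by
      refine algHom_ext fun i => ?_
      rw [AlgHom.comp_apply, aeval_X, aeval_X, map_mul, map_add, aeval_X, aeval_C, aeval_C]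
      rfl
    rw [← h1, AlgHom.comp_apply]
    refine hyI _ ?_
    rw [Ideal.mem_comap, ← AlgHom.comp_apply, hψψ']
    exact hf
  · rw [tpow_mul_mem_valLE_iff, sub_self]
    exact add_mem (valLT_le_valLE 0 (hy i)) (C_mem_valLE _)
  · rw [coeff_tpow_mul, sub_self, HahnSeries.coeff_add, hy i 0 le_rfl, zero_add]
    exact HahnSeries.coeff_single_same _ _

theorem leadingParts_zeroLocus (I : Ideal (MvPolynomial (Fin n) RevHahn)) :
    leadingParts (zeroLocus RevHahn I) =
      ⋃ α : ℝ, {α} ×ˢ (zeroLocus ℂ (initIdeal α I) \ {0}) := by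
  ext ⟨α, B⟩
  simp only [leadingParts, Set.mem_image, Set.mem_iUnion, Set.mem_prod, Set.mem_singleton_iff,
    Set.mem_sdiff]
  constructor
  · rintro ⟨z, ⟨hzI, hz0⟩, hz⟩
    obtain ⟨α', h1, h2⟩ := exists_level hz0
    rw [leadingPart_eq h1 h2, Prod.mk.injEq] at hz
    obtain ⟨rfl, rfl⟩ := hz
    exact ⟨α', rfl, coeff_mem_zeroLocus hzI h1, h2⟩
  · rintro ⟨α, rfl, hB, hB0⟩
    obtain ⟨z, hzI, h1, rfl⟩ := exists_mem_zeroLocus_coeff_eq hB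
    refine ⟨z, ⟨hzI, ?_⟩, leadingPart_eq h1 hB0⟩
    rintro rfl
    exact hB0 (funext fun i => HahnSeries.coeff_zero)

end AffineTrop
end

theorem theorem1p1 (n : ℕ) (I : Ideal (MvPolynomial (Fin n) AffineTrop.RevHahn)) :
    AffineTrop.leadingParts (MvPolynomial.zeroLocus AffineTrop.RevHahn I) =
        ⋃ α : ℝ, {α} ×ˢ (MvPolynomial.zeroLocus ℂ (AffineTrop.initIdeal α I) \ {0}) ∧
    ∃ (r : ℕ) (β : Fin r → ℝ), StrictMono β ∧
      (∀ i : Fin (r + 1),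
        (∀ α ∈ AffineTrop.gap β i, AffineTrop.IsHomogeneousIdeal (AffineTrop.initIdeal α I)) ∧
        (∀ α ∈ AffineTrop.gap β i, ∀ α' ∈ AffineTrop.gap β i,
          AffineTrop.initIdeal α I = AffineTrop.initIdeal α' I)) ∧
      (∀ j : Fin r, ¬ AffineTrop.IsHomogeneousIdeal (AffineTrop.initIdeal (β j) I)) :=
  ⟨AffineTrop.leadingParts_zeroLocus I, AffineTrop.exists_criticalLevels I⟩
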